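/- Let $R$ be a commutative noetherian domain; all modules are finitely generated. An $R$-module $M$ is maximal Cohen--Macaulay (MCM) if $\operatorname{depth} M_{\mathfrak p}\ge \operatorname{ht}\mathfrak p$ for all primes $\mathfrak p$ of $R$ (with $\operatorname{depth}0=\infty$), and pseudo-zero if $M_{\mathfrak p}=0$ for all primes $\mathfrak p$ with $\operatorname{ht}\mathfrak p\le 1$. Let $\mathsf H(R)$ be the quotient of the Grothendieck group of finitely generated $R$-modules by the subgroup generated by the classes of pseudo-zero modules, and put $\mathsf H(R)_{\mathbb R}=\mathsf H(R)\otimes_{\mathbb Z}\mathbb R$. Let $\mathsf K(R)$ be the kernel of the rank function $\operatorname{rk}:\mathsf H(R)\to\mathbb Z$, let $\mathsf K(R)_{\mathbb R}\subseteq\mathsf H(R)_{\mathbb R}$ be its real extension, and let $\operatorname{rk}_{\mathbb R}:\mathsf H(R)_{\mathbb R}\to\mathbb R$ be the extended rank function. Assume $\dim_{\mathbb R}\mathsf H(R)_{\mathbb R}<\infty$ and give $\mathsf H(R)_{\mathbb R}$ the Euclidean metric for which some fixed basis is orthonormal (the notions below do not depend on the basis). Let $r$ be a positive integer. Let $\mathsf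 C_r(R)=\sum_{M}\mathbb R_{\ge0}[M]\subseteq\mathsf H(R)_{\mathbb R}$, where $M$ runs over the MCM $R$-modules of rank $r$, and let $\mathsf C_r^0(R)=\{x\in\mathsf C_r(R)\mid\operatorname{rk}_{\mathbb R}(x)=r\}$. A rank $r$ MCM point is an element of $\mathsf H(R)_{\mathbb R}$ of the form $[M]$ with $M$ an MCM $R$-module of rank $r$. A convex cone is polyhedral if it is spanned by finitely many vectors, and a convex cone $C$ is strongly convex if $C\cap(-C)=\{0\}$. Consider the following conditions. - (a) There are only finitely many nonisomorphic MCM $R$-modules of rank $r$. - (b) There are only finitely many rank $r$ MCM points in $\mathsf C_r(R)$. - (c) The convex cone $\mathsf C_r(R)$ is polyhedral. - (d) The subset $\mathsf C_r(R)$ of $\mathsf H(R)_{\mathbb R}$ is closed. - (e) $\overline{\mathsf C_r(R)}\cap\mathsf K(R)_{\mathbb R}=\{0\}$. - (f) The subset $\mathsf C_r^0(R)$ of $\mathsf H(R)_{\mathbb R}$ is bounded. - (g) The convex cone $\overline{\mathsf C_r(R)}$ is strongly convex. Then the implications (a) $\Rightarrow$ (b) $\Rightarrow$ (c) $\Rightarrow$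 (d) $\Rightarrow$ (e) $\Leftrightarrow$ (f) $\Rightarrow$ (g) hold. If $\mathsf H(R)$ is a finitely generated abelian group, then (b)--(f) are equivalent. If $R$ is normal, $\mathsf H(R)$ is finitely generated and $r=1$, then (a)--(f) are equivalent. If $R$ is a normal Cohen--Macaulay ring with a canonical module (a module $\omega$ such that $\omega_{\mathfrak p}$ is a canonical module of the local ring $R_{\mathfrak p}$ for every prime $\mathfrak p$), then (e) and (g) are equivalent. -/

import Mathlib

/-! Grothendieck groups modulo pseudo-zero modules and the cones spanned by maximal
Cohen-Macaulay modules, for a commutative (noetherian) ring. All modules are finitely generated. -/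

universe u

noncomputable section

open CategoryTheory TensorProduct

namespace CMCone

/-! ### Depth and maximal Cohen-Macaulay modules -/

section LocalDepth

variable (A : Type u) [CommRing A] [IsLocalRing A] (C : Type u) [AddCommGroup C] [Module A C]

/-- The depth of a (finitely generated) module `C` over a local ring: the supremum of the lengths
of `C`-regular sequences in the maximal ideal. By Nakayama, weakly regular sequences in the maximal
ideal are regular if `C ≠ 0`; every sequence is weakly regular on `C = 0`, so `depth 0 = ∞`. -/
def localDepth : ℕ∞ :=
  ⨆ (rs : List A) (_ : RingTheory.Sequence.IsWeaklyRegular C rs ∧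
    ∀ x ∈ rs, x ∈ IsLocalRing.maximalIdeal A), (rs.length : ℕ∞)

/-- A canonical module of a (Cohen-Macaulay noetherian) local ring `A`: a finitely generated maximal
Cohen-Macaulay module of finite injective dimension and of type one, i.e.
`dim_k Ext^t(k, C) = 1` for `t = depth C` (the length over `A` of `Ext^t(k, C)` is its
dimension over the residue field `k`). -/
def IsLocalCanonicalModule : Prop :=
  Module.Finite A C ∧
  (IsLocalRing.maximalIdeal A).height ≤ localDepth A C ∧
  (∃ n : ℕ, HasInjectiveDimensionLE (ModuleCat.of A C) n) ∧
  ∃ t : ℕ, localDepth A C = t ∧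
    Module.length A (Abelian.Ext (ModuleCat.of A (IsLocalRing.ResidueField A))
      (ModuleCat.of A C) t) = 1

end LocalDepth

section Global

variable (R : Type u) [CommRing R] (M : Type u) [AddCommGroup M] [Module R M]

/-- `M` is maximal Cohen-Macaulay: `depth M_p ≥ height p` for all primes `p`
(`M` is meant to be finitely generated). A noetherian ring `R` is Cohen-Macaulay if and only if
`IsMCM R R`. -/
def IsMCM : Prop :=
  ∀ (p : Ideal R) [p.IsPrime],
    p.height ≤ localDepth (Localization.AtPrime p) (LocalizedModule p.primeCompl M)

/-- A canonical module of a Cohen-Macaulay ring `R`: a finitely generated module whose localization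
at every prime `p` is a canonical module of `R_p`. -/
def IsCanonicalModule : Prop :=
  Module.Finite R M ∧ ∀ (p : Ideal R) [p.IsPrime],
    IsLocalCanonicalModule (Localization.AtPrime p) (LocalizedModule p.primeCompl M)

/-- `M` is pseudo-zero: `M_p = 0` for all primes `p` of height at most one. -/
def IsPseudoZero : Prop :=
  ∀ (p : Ideal R) [p.IsPrime], p.height ≤ 1 → Subsingleton (LocalizedModule p.primeCompl M)

end Global

/-! ### The groups `G(R)` and `H(R)` -/

section Groups

variable (R : Type u) [CommRing R]

/-- The elements `[M₂] - [M₁] - [M₃]` for short exact sequences `0 → M₁ → M₂ → M₃ → 0` of finitely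
generated modules. -/
def exactRelations : Set (FreeAbelianGroup (FGModuleCat.{u} R)) :=
  {x | ∃ (M₁ M₂ M₃ : FGModuleCat.{u} R) (f : M₁ →ₗ[R] M₂) (g : M₂ →ₗ[R] M₃),
    Function.Injective f ∧ Function.Exact f g ∧ Function.Surjective g ∧
    x = FreeAbelianGroup.of M₂ - FreeAbelianGroup.of M₁ - FreeAbelianGroup.of M₃}

/-- The Grothendieck group `G(R)` of finitely generated `R`-modules. -/
abbrev G : Type (u + 1) :=
  FreeAbelianGroup (FGModuleCat.{u} R) ⧸ AddSubgroup.closure (exactRelations R)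

variable {R} in
/-- The class of a finitely generated module in `G(R)`. -/
def G.cls (M : FGModuleCat.{u} R) : G R :=
  QuotientAddGroup.mk (FreeAbelianGroup.of M)

/-- The quotient `H(R)` of `G(R)` by the subgroup generated by the classes of
pseudo-zero modules. -/
abbrev H : Type (u + 1) :=
  G R ⧸ AddSubgroup.closure {x : G R | ∃ M : FGModuleCat.{u} R, IsPseudoZero R M ∧ x = G.cls M}

variable {R} in
/-- The class of a finitely generated module in `H(R)`. -/
def H.cls (M : FGModuleCat.{u} R) : H R :=
  QuotientAddGroup.mk (G.cls M)

/-- The real vector space `H(R)_ℝ`. -/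
abbrev HR : Type (u + 1) := ℝ ⊗[ℤ] H R

variable {R} in
/-- The class of a finitely generated module in `H(R)_ℝ`. -/
def HR.cls (M : FGModuleCat.{u} R) : HR R := (1 : ℝ) ⊗ₜ[ℤ] H.cls M

end Groups

/-! ### The rank over a domain -/

section Rank

variable (R : Type u) [CommRing R]

section
variable [IsDomain R]

theorem finrank_exact {M₁ M₂ M₃ : FGModuleCat.{u} R} {f : M₁ →ₗ[R] M₂} {g : M₂ →ₗ[R] M₃}
    (hf : Function.Injective f) (hfg : Function.Exact f g) (hg : Function.Surjective g) :
    Module.finrank R M₂ = Module.finrank R M₁ + Module.finrank R M₃ := by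
  have h1 := Submodule.finrank_quotient_add_finrank (LinearMap.range f)
  have h2 : Module.finrank R (M₂ ⧸ LinearMap.range f) = Module.finrank R M₃ := by
    have e : LinearMap.range f = LinearMap.ker g := (LinearMap.exact_iff.mp hfg).symm
    rw [e]
    exact (g.quotKerEquivOfSurjective hg).finrank_eq
  have h3 : Module.finrank R (LinearMap.range f) = Module.finrank R M₁ :=
    LinearMap.finrank_range_of_inj hf
  omega

theorem finrank_of_isPseudoZero {M : FGModuleCat.{u} R} (h : IsPseudoZero R M) :
    Module.finrank R M = 0 := by
  have h0 : (⊥ : Ideal R).height ≤ 1 := by simp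
  have := h ⊥ h0
  rw [Module.finrank_eq_zero_iff]
  intro x
  have hx : LocalizedModule.mk x (1 : (⊥ : Ideal R).primeCompl) = 0 := Subsingleton.elim _ _
  rw [← LocalizedModule.zero_mk 1, LocalizedModule.mk_eq] at hx
  obtain ⟨c, hc⟩ := hx
  refine ⟨c.1, fun hz => c.2 (by simp [hz]), ?_⟩
  simpa [Submonoid.smul_def] using hc

/-- The rank function `G(R) → ℤ` of a domain, `[M] ↦ rank M`. -/
def rkG : G R →+ ℤ :=
  QuotientAddGroup.lift _ (FreeAbelianGroup.lift fun M => (Module.finrank R M : ℤ)) <| by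
    rw [AddSubgroup.closure_le]
    rintro _ ⟨M₁, M₂, M₃, f, g, hf, hfg, hg, rfl⟩
    have := finrank_exact R hf hfg hg
    simp only [SetLike.mem_coe, AddMonoidHom.mem_ker, map_sub, FreeAbelianGroup.lift_apply_of]
    omega

/-- The rank function `H(R) → ℤ` of a domain, `[M] ↦ rank M`. -/
def rk : H R →+ ℤ :=
  QuotientAddGroup.lift _ (rkG R) <| by
    rw [AddSubgroup.closure_le]
    rintro _ ⟨M, hM, rfl⟩
    have := finrank_of_isPseudoZero R hM
    simp [G.cls, rkG, this]

/-- The rank of a class in `H(R)` is the rank of the module. -/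
theorem rk_cls (M : FGModuleCat.{u} R) : rk R (H.cls M) = Module.finrank R M := by
  exact FreeAbelianGroup.lift_apply_of (fun M : FGModuleCat.{u} R => (Module.finrank R M : ℤ)) M

/-- The kernel `K(R)` of the rank function. -/
def K : AddSubgroup (H R) := (rk R).ker

/-- The subspace `K(R)_ℝ` of `H(R)_ℝ`: the image of `K(R) ⊗ ℝ`. -/
def KR : Submodule ℝ (HR R) :=
  LinearMap.range ((K R).subtype.toIntLinearMap.baseChange ℝ)

/-- The real extension `H(R)_ℝ → ℝ` of the rank function. -/
def rkR : HR R →ₗ[ℝ] ℝ :=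
  (TensorProduct.AlgebraTensorModule.rid ℤ ℝ ℝ).toLinearMap ∘ₗ
    (rk R).toIntLinearMap.baseChange ℝ

theorem rkR_tmul (a : ℝ) (x : H R) : rkR R (a ⊗ₜ x) = a * rk R x := by
  simp [rkR, mul_comm]

/-- `K(R)_ℝ` is the kernel of the real rank function. -/
theorem mem_KR_iff (x : HR R) : x ∈ KR R ↔ rkR R x = 0 := by
  constructor
  · rintro ⟨y, rfl⟩
    induction y using TensorProduct.induction_on with
    | zero => simp
    | tmul a k =>
      have hk : rk R (k : H R) = 0 := k.2
      simp [rkR_tmul, hk]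
    | add y z hy hz => simp [hy, hz]
  · intro h
    have key : ∀ y : HR R,
        y - rkR R y • HR.cls (FGModuleCat.of R R) ∈ KR R := by
      intro y
      induction y using TensorProduct.induction_on with
      | zero => simp
      | tmul a z =>
        have hz : z - rk R z • H.cls (FGModuleCat.of R R) ∈ K R := by
          change rk R _ = 0
          rw [map_sub, map_zsmul, rk_cls]
          simp
        refine ⟨a ⊗ₜ ⟨_, hz⟩, ?_⟩
        rw [LinearMap.baseChange_tmul, rkR_tmul]
        simp only [AddMonoidHom.coe_toIntLinearMap, AddSubgroup.coe_subtype, HR.cls,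
          TensorProduct.tmul_sub, TensorProduct.smul_tmul', TensorProduct.tmul_smul]
        congr 2
        simp [mul_comm]
      | add y z hy hz =>
        have := (KR R).add_mem hy hz
        rw [map_add, add_smul]
        convert this using 1
        abel
    have := key x
    rwa [h, zero_smul, sub_zero] at this

end

/-! ### Maximal Cohen-Macaulay points and cones -/

/-- The rank `r` maximal Cohen-Macaulay points of `H(R)_ℝ`. -/
def mcmPoints (r : ℕ) : Set (HR R) :=
  {x | ∃ M : FGModuleCat.{u} R, IsMCM R M ∧ Module.finrank R M = r ∧ x = HR.cls M}

/-- The convex cone `C_r(R)` in `H(R)_ℝ` spanned by the maximal Cohen-Macaulay modules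
of rank `r`. -/
def mcmCone (r : ℕ) : PointedCone ℝ (HR R) := PointedCone.hull ℝ (mcmPoints R r)

end Rank

/-! ### The Euclidean metric on `H(R)_ℝ` -/

/-- The Euclidean metric on `H(R)_ℝ` for which the basis `b` is orthonormal. -/
abbrev euclideanMetric {R : Type u} [CommRing R] {n : ℕ} (b : Module.Basis (Fin n) ℝ (HR R)) :
    MetricSpace (HR R) :=
  MetricSpace.induced (fun x => (WithLp.toLp 2 (b.equivFun x) : EuclideanSpace ℝ (Fin n)))
    ((WithLp.toLp_injective 2).comp b.equivFun.injective) inferInstance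

/-! ### The conditions -/

section Conditions

variable (R : Type u) [CommRing R] (r : ℕ)

/-- Up to isomorphism there are only finitely many maximal Cohen-Macaulay modules of rank `r`. -/
def FinitelyManyMCM : Prop :=
  ∃ S : Set (FGModuleCat.{u} R), S.Finite ∧
    ∀ M : FGModuleCat.{u} R, IsMCM R M → Module.finrank R M = r →
      ∃ N ∈ S, Nonempty (M ≃ₗ[R] N)

/-- There are only finitely many rank `r` maximal Cohen-Macaulay points in `C_r(R)`. -/
def FinitelyManyPoints : Prop := (mcmPoints R r ∩ (mcmCone R r : Set (HR R))).Finite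

/-- `C_r(R)` is polyhedral: it is spanned by finitely many vectors. -/
def ConePolyhedral : Prop := ∃ s : Finset (HR R), mcmCone R r = PointedCone.hull ℝ (s : Set (HR R))

variable {R} {n : ℕ} (b : Module.Basis (Fin n) ℝ (HR R))

/-- `C_r(R)` is a closed subset of `H(R)_ℝ`. -/
def ConeClosed : Prop :=
  letI := euclideanMetric b
  IsClosed (mcmCone R r : Set (HR R))

/-- The closure of `C_r(R)` in `H(R)_ℝ`. -/
def coneClosure : Set (HR R) :=
  letI := euclideanMetric b
  closure (mcmCone R r : Set (HR R))

/-- The closure of `C_r(R)` meets `K(R)_ℝ` only at the origin. -/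
def ClosureMeetsKTrivially [IsDomain R] : Prop := coneClosure r b ∩ (KR R : Set (HR R)) = {0}

/-- The set of the points of `C_r(R)` of rank `r` is bounded. -/
def SliceBounded [IsDomain R] : Prop :=
  letI := euclideanMetric b
  Bornology.IsBounded {x : HR R | x ∈ mcmCone R r ∧ rkR R x = r}

/-- The closure of `C_r(R)` is strongly convex: it meets its negative only at the origin. -/
def ClosureStronglyConvex : Prop :=
  {x : HR R | x ∈ coneClosure r b ∧ -x ∈ coneClosure r b} = {0}

end Conditions

end CMCone

end

/-! The rank is positive on `C_r(R) ∖ {0}`. So if the cone is spanned by finitely many vectors, it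
is the cone over a compact convex set avoiding the origin, hence closed; and since the unit sphere
of the closure is compact, the closure meets the kernel of the rank trivially if and only if the
norm is bounded on the cone by a multiple of the rank, i.e. if and only if the slice of rank `r` is
bounded. A bounded subset of `H(R)_ℝ` contains the images of only finitely many elements of `H(R)`
if `H(R)` is finitely generated.

Now let `R` be normal. Comparing a torsion-free module `M` with a free submodule of the same rank,
the lengths of the quotient at the primes of height one give a divisor, whose class modulo
principal divisors is additive on exact sequences and vanishes on pseudo-zero modules. If two
modules of rank one have the same class, they embed into `Frac R` with the same localizations in
codimension one; being maximal Cohen-Macaulay they satisfy Serre's condition `S₂`, so they are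
isomorphic.

If `ω` is a canonical module, then `M ↦ Hom(M, ω)` preserves maximal Cohen-Macaulay modules and
ranks, and `[Hom(M, ω)] = rank M • ([R] + [ω]) - [M]` because both sides can be computed on
lattices over the discrete valuation rings in codimension one. Hence `x ↦ rank x • ([R] + [ω]) - x`
maps the closure of the cone to itself, and on vectors of rank zero it is `x ↦ -x`. -/

noncomputable section

open CategoryTheory TensorProduct

namespace CMCone

/-! ### Duals of maximal Cohen-Macaulay modules over a local ring -/

section ExtSequences

open Abelian

variable {A : Type*} [Category A] [Abelian A] [HasExt A] {S : ShortComplex A}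

theorem subsingleton_ext_X₁ (hS : S.ShortExact) {Y : A} {n : ℕ}
    (h₂ : Subsingleton (Ext S.X₂ Y n)) (h₃ : Subsingleton (Ext S.X₃ Y (1 + n))) :
    Subsingleton (Ext S.X₁ Y n) := by
  refine subsingleton_of_forall_eq 0 fun x ↦ ?_
  obtain ⟨z, rfl⟩ := Ext.contravariant_sequence_exact₁ hS Y x rfl (h₃.elim _ _)
  rw [h₂.elim z 0, Ext.comp_zero]

theorem subsingleton_ext_X₂ (hS : S.ShortExact) {Y : A} {n : ℕ}
    (h₁ : Subsingleton (Ext S.X₁ Y n)) (h₃ : Subsingleton (Ext S.X₃ Y n)) :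
    Subsingleton (Ext S.X₂ Y n) := by
  refine subsingleton_of_forall_eq 0 fun x ↦ ?_
  obtain ⟨z, rfl⟩ := Ext.contravariant_sequence_exact₂ hS Y x (h₁.elim _ _)
  rw [h₃.elim z 0, Ext.comp_zero]

theorem subsingleton_ext_to_X₃ (hS : S.ShortExact) {X : A} {n : ℕ}
    (h₂ : Subsingleton (Ext X S.X₂ n)) (h₁ : Subsingleton (Ext X S.X₁ (n + 1))) :
    Subsingleton (Ext X S.X₃ n) := by
  refine subsingleton_of_forall_eq 0 fun x ↦ ?_
  obtain ⟨z, rfl⟩ := Ext.covariant_sequence_exact₃ X hS x rfl (h₁.elim _ _)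
  rw [h₂.elim z 0, Ext.zero_comp]

theorem subsingleton_ext_of_iso {X X' : A} (e : X ≅ X') {Y : A} {n : ℕ}
    (h : Subsingleton (Ext X' Y n)) : Subsingleton (Ext X Y n) := by
  refine subsingleton_of_forall_eq 0 fun x ↦ ?_
  rw [← Ext.mk₀_id_comp x, ← e.hom_inv_id, ← Ext.mk₀_comp_mk₀_assoc,
    h.elim ((Ext.mk₀ e.inv).comp x (zero_add n)) 0, Ext.comp_zero]

theorem exists_comp_eq_of_subsingleton_ext_one (hS : S.ShortExact) {X : A}
    (h : Subsingleton (Ext X S.X₁ 1)) (φ : X ⟶ S.X₃) : ∃ ψ : X ⟶ S.X₂, ψ ≫ S.g = φ := by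
  obtain ⟨z, hz⟩ := Ext.covariant_sequence_exact₃ X hS (Ext.mk₀ φ) rfl (h.elim _ _)
  obtain ⟨ψ, rfl⟩ := Ext.addEquiv₀.symm.surjective z
  refine ⟨ψ, Ext.addEquiv₀.symm.injective ?_⟩
  simpa only [Ext.addEquiv₀_symm_apply, Ext.mk₀_comp_mk₀] using hz

end ExtSequences

section LinearMapRegular

open Abelian RingTheory.Sequence
open scoped Pointwise

variable {A : Type u} [CommRing A]
variable {N C : Type u} [AddCommGroup N] [Module A N] [AddCommGroup C] [Module A C]

theorem ker_compRight_mkQ_smul_top {y : A} (hy : IsSMulRegular C y) :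
    LinearMap.ker (LinearMap.compRight A (M := N) (y • (⊤ : Submodule A C)).mkQ) =
      y • (⊤ : Submodule A (N →ₗ[A] C)) := by
  ext f
  simp only [LinearMap.mem_ker, LinearMap.ext_iff, LinearMap.compRight_apply,
    LinearMap.comp_apply, Submodule.mkQ_apply, LinearMap.zero_apply,
    Submodule.Quotient.mk_eq_zero, Submodule.mem_smul_pointwise_iff_exists, Submodule.mem_top,
    true_and, LinearMap.smul_apply]
  refine ⟨fun hf ↦ ?_, fun ⟨g, hg⟩ x ↦ ⟨g x, hg x⟩⟩
  choose g hg using hf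
  exact ⟨⟨⟨g, fun a b ↦ hy (by simp only [smul_add, hg, map_add])⟩,
    fun a b ↦ hy (by simp only [RingHom.id_apply, smul_comm y a, hg, map_smul])⟩, hg⟩

theorem compRight_mkQ_smul_top_surjective {y : A} (hy : IsSMulRegular C y)
    (h : Subsingleton (Ext (ModuleCat.of A N) (ModuleCat.of A C) 1)) :
    Function.Surjective (LinearMap.compRight A (M := N) (y • (⊤ : Submodule A C)).mkQ) := by
  intro φ
  obtain ⟨ψ, hψ⟩ := exists_comp_eq_of_subsingleton_ext_one
    (IsSMulRegular.smulShortComplex_shortExact (M := ModuleCat.of A C) hy) h (ModuleCat.ofHom φ)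
  exact ⟨ψ.hom, congr_arg ModuleCat.Hom.hom hψ⟩

/-- The identification `Hom(N, C) / y Hom(N, C) ≃ Hom(N, C / y C)` for a `C`-regular element `y`,
valid as soon as `Ext¹(N, C) = 0`. -/
def quotSMulTopLinearMapEquiv {y : A} (hy : IsSMulRegular C y)
    (h : Subsingleton (Ext (ModuleCat.of A N) (ModuleCat.of A C) 1)) :
    QuotSMulTop y (N →ₗ[A] C) ≃ₗ[A] (N →ₗ[A] QuotSMulTop y C) :=
  (Submodule.quotEquivOfEq _ _ (ker_compRight_mkQ_smul_top hy).symm).trans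
    (LinearMap.quotKerEquivOfSurjective _ (compRight_mkQ_smul_top_surjective hy h))

theorem isWeaklyRegular_linearMap {rs : List A} (hrs : IsWeaklyRegular C rs)
    (h : ∀ i > 0, Subsingleton (Ext (ModuleCat.of A N) (ModuleCat.of A C) i)) :
    IsWeaklyRegular (N →ₗ[A] C) rs := by
  induction rs generalizing C with
  | nil => exact IsWeaklyRegular.nil _ _
  | cons r rs ih =>
    rw [isWeaklyRegular_cons_iff] at hrs ⊢
    refine ⟨fun f g hfg ↦ LinearMap.ext fun x ↦ hrs.1 (LinearMap.congr_fun hfg x), ?_⟩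
    rw [(quotSMulTopLinearMapEquiv hrs.1 (h 1 one_pos)).isWeaklyRegular_congr]
    exact ih hrs.2 fun i hi ↦ subsingleton_ext_to_X₃
      (IsSMulRegular.smulShortComplex_shortExact (M := ModuleCat.of A C) hrs.1)
      (h i hi) (h _ (by omega))

end LinearMapRegular

section LocalMCM

open Abelian RingTheory.Sequence IsLocalRing

variable {A : Type u} [CommRing A] [IsLocalRing A]
variable {N C : Type u} [AddCommGroup N] [Module A N] [AddCommGroup C] [Module A C]

theorem exists_isWeaklyRegular_of_le_localDepth {d : ℕ} (h : (d : ℕ∞) ≤ localDepth A C) :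
    ∃ rs : List A, IsWeaklyRegular C rs ∧ (∀ x ∈ rs, x ∈ maximalIdeal A) ∧ rs.length = d := by
  obtain rfl | hd := Nat.eq_zero_or_pos d
  · exact ⟨[], IsWeaklyRegular.nil _ _, by simp, rfl⟩
  have hlt : ((d - 1 : ℕ) : ℕ∞) < localDepth A C :=
    lt_of_lt_of_le (by exact_mod_cast (by omega : d - 1 < d)) h
  simp only [localDepth, lt_iSup_iff, Nat.cast_lt] at hlt
  obtain ⟨rs, ⟨hrs, hm⟩, hlen⟩ := hlt
  refine ⟨rs.take d, ?_, fun x hx ↦ hm x (List.mem_of_mem_take hx), by simp; omega⟩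
  rw [← List.take_append_drop d rs, isWeaklyRegular_append_iff] at hrs
  exact hrs.1

theorem length_le_localDepth {rs : List A} (hrs : IsWeaklyRegular C rs)
    (hm : ∀ x ∈ rs, x ∈ maximalIdeal A) : (rs.length : ℕ∞) ≤ localDepth A C :=
  le_iSup₂_of_le rs ⟨hrs, hm⟩ le_rfl

theorem localDepth_congr (e : N ≃ₗ[A] C) : localDepth A N = localDepth A C := by
  simp only [localDepth, e.isWeaklyRegular_congr]

variable (A C) in
/-- The maximal Cohen-Macaulay condition over a local ring, which `IsMCM` imposes at every
localization; in particular `0` satisfies it. -/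
def IsLocalMCM : Prop :=
  (maximalIdeal A).height ≤ localDepth A C

theorem IsLocalMCM.exists_isWeaklyRegular [IsNoetherianRing A] (h : IsLocalMCM A C) :
    ∃ rs : List A, IsWeaklyRegular C rs ∧ (∀ x ∈ rs, x ∈ maximalIdeal A) ∧
      (maximalIdeal A).height = rs.length := by
  obtain ⟨d, hd⟩ := ENat.ne_top_iff_exists.mp
    (Ideal.height_ne_top (maximalIdeal.isMaximal A).ne_top)
  obtain ⟨rs, hrs, hm, rfl⟩ := exists_isWeaklyRegular_of_le_localDepth (hd.trans_le h)
  exact ⟨rs, hrs, hm, hd.symm⟩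

theorem maximalIdeal_mem_associatedPrimes_of_supportDim_nonpos [IsNoetherianRing A]
    [Nontrivial C] (h : Module.supportDim A C ≤ 0) : maximalIdeal A ∈ associatedPrimes A C := by
  obtain ⟨p, hp⟩ := associatedPrimes.nonempty A C
  obtain ⟨hpp, x, hpx⟩ := isAssociatedPrime_iff.mp hp
  have hsupp : ⟨p, hpp⟩ ∈ Module.support A C := Module.mem_support_iff'.mpr ⟨x, fun a ha hax ↦
    ha (by simpa only [hpx, Submodule.mem_colon_singleton, Submodule.mem_bot] using hax)⟩
  have hle : (⟨p, hpp⟩ : PrimeSpectrum A) ≤ closedPoint A := le_maximalIdeal hpp.ne_top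
  have hmax := Order.krullDim_nonpos_iff_forall_isMax.mp h ⟨_, hsupp⟩
  have hge : maximalIdeal A ≤ p :=
    hmax (b := ⟨closedPoint A, Module.mem_support_mono hle hsupp⟩) hle
  have heq : p = maximalIdeal A := le_antisymm hle hge
  rwa [← heq]

/-- A maximal regular sequence of a Cohen-Macaulay local ring cuts out a ring in which the
maximal ideal is associated to `0`. -/
theorem exists_injective_residueField_of_isWeaklyRegular [IsNoetherianRing A] {rs : List A}
    (hrs : IsWeaklyRegular A rs) (hm : ∀ x ∈ rs, x ∈ maximalIdeal A)
    (hlen : (maximalIdeal A).height = rs.length) :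
    ∃ f : (A ⧸ maximalIdeal A) →ₗ[A] (A ⧸ (Ideal.ofList rs • ⊤ : Submodule A A)),
      Function.Injective f := by
  have hreg : IsRegular A rs :=
    (isRegular_iff_isWeaklyRegular_of_subset_maximalIdeal hm).mpr hrs
  have hdim : Module.supportDim A (A ⧸ (Ideal.ofList rs • ⊤ : Submodule A A)) ≤ 0 := by
    have hadd := Module.supportDim_add_length_eq_supportDim_of_isRegular rs hreg
    rw [Module.supportDim_self_eq_ringKrullDim, ← maximalIdeal_height_eq_ringKrullDim, hlen]
      at hadd
    rw [← ENat.WithBot.add_le_add_natCast_right_iff (c := rs.length), hadd, zero_add]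
    rfl
  have : Nontrivial (A ⧸ (Ideal.ofList rs • ⊤ : Submodule A A)) :=
    Submodule.Quotient.nontrivial_iff.mpr hreg.top_ne_smul.symm
  exact ((isAssociatedPrime_iff_exists_injective_linearMap _ _).mp
    (maximalIdeal_mem_associatedPrimes_of_supportDim_nonpos hdim)).2

variable [IsNoetherianRing A]

theorem subsingleton_ext_of_quotSMulTop {N C : ModuleCat.{u} A} [Module.Finite A N]
    [Module.Finite A C] {y : A} (hy : IsSMulRegular N y) (hm : y ∈ maximalIdeal A) {n : ℕ}
    (h : Subsingleton (Ext (ModuleCat.of A (QuotSMulTop y N)) C (1 + n))) :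
    Subsingleton (Ext N C n) := by
  have mk₀_smul_comp (z : Ext N C n) : (Ext.mk₀ (y • 𝟙 N)).comp z (zero_add n) = y • z := by
    rw [Ext.mk₀_smul, Ext.smul_comp, Ext.mk₀_id_comp]
  have y_smul_surjective (x : Ext N C n) : ∃ z : Ext N C n, y • z = x := by
    obtain ⟨z, hz⟩ := Ext.contravariant_sequence_exact₁ hy.smulShortComplex_shortExact C x rfl
      (h.elim _ _)
    exact ⟨z, (mk₀_smul_comp z).symm.trans hz⟩
  have top_le : (⊤ : Submodule A (Ext N C n)) ≤ maximalIdeal A • ⊤ := by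
    rintro x -
    obtain ⟨z, rfl⟩ := y_smul_surjective x
    exact Submodule.smul_mem_smul hm Submodule.mem_top
  have := Submodule.eq_bot_of_le_smul_of_le_jacobson_bot _ _ Module.Finite.fg_top top_le
    (maximalIdeal_le_jacobson _)
  exact (Submodule.subsingleton_iff A).mp (subsingleton_of_bot_eq_top this.symm)

theorem subsingleton_ext_quotient_of_ne_maximalIdeal {p : Ideal A} [p.IsPrime]
    (hp : p ≠ maximalIdeal A) {C : ModuleCat.{u} A} [Module.Finite A C] {i : ℕ}
    (h : ∀ (N : Type u) [AddCommGroup N] [Module A N] [Module.Finite A N],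
      Subsingleton (Ext (ModuleCat.of A N) C (1 + i))) :
    Subsingleton (Ext (ModuleCat.of A (A ⧸ p)) C i) := by
  obtain ⟨y, hym, hyp⟩ := SetLike.exists_of_lt
    (lt_of_le_of_ne (le_maximalIdeal (Ideal.IsPrime.ne_top ‹_›)) hp)
  have hy : IsSMulRegular (A ⧸ p) y := (isSMulRegular_quotient_iff_mem_of_smul_mem _ _).mpr
    fun x hx ↦ (Ideal.IsPrime.mem_or_mem ‹_› hx).resolve_left hyp
  exact subsingleton_ext_of_quotSMulTop (N := ModuleCat.of A (A ⧸ p)) hy hym (h _)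

theorem subsingleton_ext_residueField_of_height_lt (hA : IsLocalMCM A A) {C : ModuleCat.{u} A}
    {i : ℕ} (hi : (maximalIdeal A).height < i)
    (h : ∀ (N : Type u) [AddCommGroup N] [Module A N] [Module.Finite A N],
      Subsingleton (Ext (ModuleCat.of A N) C (1 + i))) :
    Subsingleton (Ext (ModuleCat.of A (A ⧸ maximalIdeal A)) C i) := by
  obtain ⟨rs, hrs, hm, hlen⟩ := hA.exists_isWeaklyRegular
  obtain ⟨f, hf⟩ := exists_injective_residueField_of_isWeaklyRegular hrs hm hlen
  have hpd : HasProjectiveDimensionLE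
      (ModuleCat.of A (A ⧸ (Ideal.ofList rs • ⊤ : Submodule A A))) rs.length := by
    have hfree : projectiveDimension (ModuleCat.of A A) ≤ (0 : ℕ) :=
      (projectiveDimension_le_iff _ _).mpr inferInstance
    rw [← projectiveDimension_le_iff]
    refine (ModuleCat.projectiveDimension_quotient_eq_add_length_of_isWeaklyRegular
      (ModuleCat.of A A) rs hrs hm).trans_le ?_
    simpa using add_le_add_left hfree (rs.length : WithBot ℕ∞)
  have hlt : rs.length < i := by exact_mod_cast hlen ▸ hi
  exact subsingleton_ext_X₁ (ModuleCat.shortComplex_shortExact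
      (ModuleCat.shortComplexOfCompEqZero f (LinearMap.range f).mkQ (LinearMap.range_mkQ_comp f))
      (LinearMap.exact_map_mkQ_range f) hf (Submodule.mkQ_surjective _))
    (HasProjectiveDimensionLT.subsingleton _ (rs.length + 1) i hlt _) (h _)

/-- The injective dimension of a finitely generated module over a Cohen-Macaulay local ring is,
if finite, at most the dimension of the ring. By descending induction on the degree and a prime
filtration only `Ext(A / p, C)` matters; a prime `p ≠ 𝔪` is handled by Nakayama's lemma, and the
residue field embeds into `A` modulo a maximal regular sequence. -/
theorem subsingleton_ext_of_height_lt (hA : IsLocalMCM A A) (C : ModuleCat.{u} A)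
    [Module.Finite A C] {n : ℕ} [HasInjectiveDimensionLE C n] {i : ℕ}
    (hi : (maximalIdeal A).height < i) (N : Type u) [AddCommGroup N] [Module A N]
    [Module.Finite A N] : Subsingleton (Ext (ModuleCat.of A N) C i) := by
  induction h : n + 1 - i generalizing i N with
  | zero => exact HasInjectiveDimensionLT.subsingleton C (n + 1) i (by omega) _
  | succ k ih =>
    have succ_vanishing (N : Type u) [AddCommGroup N] [Module A N] [Module.Finite A N] :
        Subsingleton (Ext (ModuleCat.of A N) C (1 + i)) :=
      ih (hi.trans (by exact_mod_cast lt_one_add i)) N (by omega)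
    induction ‹Module.Finite A N› using
      IsNoetherianRing.induction_on_isQuotientEquivQuotientPrime A with
    | subsingleton N =>
      have := (ModuleCat.isZero_of_subsingleton (ModuleCat.of A N)).hasProjectiveDimensionLT_zero
      exact HasProjectiveDimensionLT.subsingleton _ 0 i (Nat.zero_le i) C
    | quotient N p f =>
      refine subsingleton_ext_of_iso f.toModuleIso ?_
      by_cases hp : p.1 = maximalIdeal A
      · rw [hp]
        exact subsingleton_ext_residueField_of_height_lt hA hi succ_vanishing
      · have := p.2
        exact subsingleton_ext_quotient_of_ne_maximalIdeal hp succ_vanishing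
    | exact N₁ N₂ N₃ f g hf hg hfg h₁ h₃ =>
      exact subsingleton_ext_X₂ (ModuleCat.shortComplex_shortExact
        (ModuleCat.shortComplexOfCompEqZero f g hfg.linearMap_comp_eq_zero) hfg hf hg) h₁ h₃

theorem subsingleton_ext_of_isWeaklyRegular (C : ModuleCat.{u} A) [Module.Finite A C] {d : ℕ}
    (h : ∀ i > d, ∀ (N : Type u) [AddCommGroup N] [Module A N] [Module.Finite A N],
      Subsingleton (Ext (ModuleCat.of A N) C i))
    {rs : List A} (hm : ∀ x ∈ rs, x ∈ maximalIdeal A) (N : ModuleCat.{u} A) [Module.Finite A N]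
    (hrs : IsWeaklyRegular N rs) {i : ℕ} (hi : d < i + rs.length) : Subsingleton (Ext N C i) := by
  induction rs generalizing N i with
  | nil => exact h i (by simpa using hi) N
  | cons r rs ih =>
    rw [isWeaklyRegular_cons_iff] at hrs
    simp only [List.mem_cons, forall_eq_or_imp, List.length_cons] at hm hi
    exact subsingleton_ext_of_quotSMulTop hrs.1 hm.1
      (ih hm.2 (ModuleCat.of A (QuotSMulTop r N)) hrs.2 (by omega))

theorem IsLocalMCM.linearMap [Module.Finite A N] [Module.Finite A C] (hA : IsLocalMCM A A)
    (hN : IsLocalMCM A N) (hC : IsLocalMCM A C) {n : ℕ}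
    [HasInjectiveDimensionLE (ModuleCat.of A C) n] : IsLocalMCM A (N →ₗ[A] C) := by
  obtain ⟨ns, hns, hnsm, hnsd⟩ := hN.exists_isWeaklyRegular
  obtain ⟨cs, hcs, hcsm, hcsd⟩ := hC.exists_isWeaklyRegular
  have hext (i : ℕ) (hi : i > 0) : Subsingleton (Ext (ModuleCat.of A N) (ModuleCat.of A C) i) :=
    subsingleton_ext_of_isWeaklyRegular (ModuleCat.of A C) (d := ns.length)
      (fun j hj N _ _ _ ↦ subsingleton_ext_of_height_lt hA (ModuleCat.of A C) (n := n)
        (hnsd ▸ Nat.cast_lt.mpr hj) N) hnsm (ModuleCat.of A N) hns (by omega)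
  rw [IsLocalMCM, hcsd]
  exact length_le_localDepth (isWeaklyRegular_linearMap hcs hext) hcsm

end LocalMCM

/-! ### Localizations of maximal Cohen-Macaulay modules -/

section IsField

open IsLocalRing RingTheory.Sequence

variable {A : Type u} [CommRing A] [IsLocalRing A] {C : Type u} [AddCommGroup C] [Module A C]

theorem localDepth_eq_zero_of_isField [Nontrivial C] (hA : IsField A) : localDepth A C = 0 := by
  by_contra h
  have hone : ((1 : ℕ) : ℕ∞) ≤ localDepth A C := by
    rwa [Nat.cast_one, Order.one_le_iff_ne_zero]
  obtain ⟨rs, hrs, hm, hlen⟩ := exists_isWeaklyRegular_of_le_localDepth hone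
  obtain ⟨x, rfl⟩ := List.length_eq_one_iff.mp hlen
  have hx : x = 0 := by
    simpa [isField_iff_maximalIdeal_eq.mp hA] using hm
  obtain ⟨y, hy⟩ := exists_ne (0 : C)
  exact hy (((isWeaklyRegular_cons_iff C x []).mp hrs).1 (by simp [hx]))

theorem localDepth_eq_top_of_subsingleton [Subsingleton C] : localDepth A C = ⊤ := by
  rw [ENat.eq_top_iff_forall_ge]
  intro n
  have hreg : IsWeaklyRegular C (List.replicate n (0 : A)) :=
    (isWeaklyRegular_iff ..).mpr fun _ _ ↦ Function.injective_of_subsingleton _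
  simpa using length_le_localDepth hreg fun x hx ↦ by simp [List.eq_of_mem_replicate hx]

theorem IsLocalCanonicalModule.finrank_eq_one (hA : IsField A) (h : IsLocalCanonicalModule A C) :
    Module.finrank A C = 1 := by
  obtain ⟨-, -, -, t, ht, hlen⟩ := h
  let := hA.toField
  have : Nontrivial C := by
    by_contra hC
    have := not_nontrivial_iff_subsingleton.mp hC
    rw [localDepth_eq_top_of_subsingleton] at ht
    exact ENat.top_ne_natCast t ht
  rw [localDepth_eq_zero_of_isField hA] at ht
  obtain rfl : t = 0 := by exact_mod_cast ht.symm
  let eA : ResidueField A ≃ₗ[A] A :=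
    Submodule.quotEquivOfEqBot (maximalIdeal A) (isField_iff_maximalIdeal_eq.mp hA)
  have e : Abelian.Ext (ModuleCat.of A (ResidueField A)) (ModuleCat.of A C) 0 ≃ₗ[A] C :=
    Abelian.Ext.linearEquiv₀.trans <| ModuleCat.homLinearEquiv.trans <|
      (eA.congrLeft C A).trans (LinearMap.ringLmapEquivSelf A A C)
  have hA1 : Module.length A A = 1 := Module.length_eq_one_iff.mpr inferInstance
  rw [e.length_eq, Module.length_of_free, hA1, mul_one, Cardinal.toENat_eq_one] at hlen
  simp [Module.finrank, hlen]

end IsField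

section Localization

open IsLocalRing RingTheory.Sequence
open scoped Pointwise nonZeroDivisors

variable {R : Type u} [CommRing R] {M N : Type u} [AddCommGroup M] [Module R M] [AddCommGroup N]
  [Module R N]

theorem height_maximalIdeal_atPrime (p : Ideal R) [p.IsPrime] :
    (maximalIdeal (Localization.AtPrime p)).height = p.height := by
  rw [← IsLocalization.height_under p.primeCompl, Localization.AtPrime.under_maximalIdeal]

theorem isMCM_iff_isLocalMCM : IsMCM R M ↔ ∀ (p : Ideal R) [p.IsPrime],
    IsLocalMCM (Localization.AtPrime p) (LocalizedModule p.primeCompl M) := by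
  simp only [IsMCM, IsLocalMCM, height_maximalIdeal_atPrime]

theorem IsCanonicalModule.isMCM (h : IsCanonicalModule R N) : IsMCM R N :=
  isMCM_iff_isLocalMCM.mpr fun p _ ↦ (h.2 p).2.1

theorem isLocalMCM_congr {A : Type u} [CommRing A] [IsLocalRing A] {C D : Type u}
    [AddCommGroup C] [Module A C] [AddCommGroup D] [Module A D] (e : C ≃ₗ[A] D) :
    IsLocalMCM A C ↔ IsLocalMCM A D := by
  rw [IsLocalMCM, localDepth_congr e, IsLocalMCM]

theorem isMCM_linearMap [IsNoetherianRing R] [Module.Finite R M] (hR : IsMCM R R) (hM : IsMCM R M)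
    (hN : IsCanonicalModule R N) : IsMCM R (M →ₗ[R] N) := by
  rw [isMCM_iff_isLocalMCM] at hR hM ⊢
  intro p _
  obtain ⟨_, hNp, ⟨n, _⟩, -⟩ := hN.2 p
  have := Module.finitePresentation_of_finite R M
  have eR : LocalizedModule p.primeCompl R ≃ₗ[Localization.AtPrime p] Localization.AtPrime p :=
    (IsLocalizedModule.linearEquiv p.primeCompl (LocalizedModule.mkLinearMap p.primeCompl R)
      (Algebra.linearMap R (Localization.AtPrime p))).extendScalarsOfIsLocalization
        p.primeCompl (Localization.AtPrime p)
  rw [isLocalMCM_congr ((Module.FinitePresentation.linearEquivMapExtendScalars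
    p.primeCompl).extendScalarsOfIsLocalization p.primeCompl (Localization.AtPrime p))]
  exact ((isLocalMCM_congr eR).mp (hR p)).linearMap (hM p) hNp (n := n)

theorem finrank_localizedModule {S : Submonoid R} (hS : S ≤ R⁰) :
    Module.finrank (Localization S) (LocalizedModule S M) = Module.finrank R M := by
  rw [IsLocalization.finrank_eq (Localization S) S hS]
  exact IsLocalizedModule.finrank_eq S (LocalizedModule.mkLinearMap S M) hS

theorem IsCanonicalModule.finrank_eq_one [IsDomain R] (h : IsCanonicalModule R N) :
    Module.finrank R N = 1 := by
  rw [← finrank_localizedModule (Ideal.primeCompl_le_nonZeroDivisors (⊥ : Ideal R))]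
  refine (h.2 ⊥).finrank_eq_one ?_
  rw [isField_iff_maximalIdeal_eq, ← Ideal.height_eq_zero_iff_eq_bot, height_maximalIdeal_atPrime,
    Ideal.height_bot]

theorem finrank_linearMap_of_isDomain [IsDomain R] [IsNoetherianRing R] [Module.Finite R M]
    [Module.Finite R N] :
    Module.finrank R (M →ₗ[R] N) = Module.finrank R M * Module.finrank R N := by
  have := Module.finitePresentation_of_finite R M
  simp only [← finrank_localizedModule (le_refl R⁰),
    ((Module.FinitePresentation.linearEquivMapExtendScalars (N := N)
      (M := M) R⁰).extendScalarsOfIsLocalization R⁰ (Localization R⁰)).finrank_eq]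
  exact Module.finrank_linearMap (FractionRing R) (FractionRing R) (LocalizedModule R⁰ M)
    (LocalizedModule R⁰ N)

theorem isDiscreteValuationRing_atPrime [IsDomain R] [IsNoetherianRing R] [IsIntegrallyClosed R]
    (p : Ideal R) [p.IsPrime] (hp : p.height = 1) :
    IsDiscreteValuationRing (Localization.AtPrime p) := by
  have hic : IsIntegrallyClosed (Localization.AtPrime p) :=
    isIntegrallyClosed_of_isLocalization _ p.primeCompl p.primeCompl_le_nonZeroDivisors
  have hfield : ¬ IsField (Localization.AtPrime p) := fun h ↦ by
    have hm := (height_maximalIdeal_atPrime p).trans hp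
    rw [isField_iff_maximalIdeal_eq.mp h, Ideal.height_bot] at hm
    exact zero_ne_one hm
  have hdim : Ring.KrullDimLE 1 (Localization.AtPrime p) := by
    rw [Ring.krullDimLE_iff, IsLocalization.AtPrime.ringKrullDim_eq_height p, hp]
    rfl
  have hded : IsDedekindDomain (Localization.AtPrime p) :=
    { hic with maximalOfPrime := fun h h' ↦ h'.isMaximal_of_ne_bot h }
  exact ((IsDiscreteValuationRing.TFAE _ hfield).out 0 2 :).mpr hded

/-! ### Serre's conditions for maximal Cohen-Macaulay modules -/

theorem isWeaklyRegular_of_forall₂_associated {rs rs' : List R}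
    (h : List.Forall₂ Associated rs rs') (hrs : IsWeaklyRegular M rs) : IsWeaklyRegular M rs' := by
  induction h generalizing M with
  | nil => exact hrs
  | @cons r _ rs rs' hr _ ih =>
    obtain ⟨c, rfl⟩ := hr
    rw [isWeaklyRegular_cons_iff] at hrs
    have htop : r • (⊤ : Submodule R M) = (r * c) • (⊤ : Submodule R M) := by
      rw [mul_smul]
      congr 1
      refine (eq_top_iff.mpr fun x _ ↦ ?_).symm
      exact (Submodule.mem_smul_pointwise_iff_exists _ _ _).mpr ⟨c⁻¹ • x, trivial, by
        rw [← Units.smul_def, smul_inv_smul]⟩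
    refine .cons (hrs.1.mul (c.isUnit.isSMulRegular M)) ?_
    exact ((Submodule.quotEquivOfEq _ _ htop).isWeaklyRegular_congr rs').mp (ih hrs.2)

theorem IsMCM.exists_isWeaklyRegular (hM : IsMCM R M) (p : Ideal R) [p.IsPrime] {n : ℕ}
    (hn : n ≤ p.height) : ∃ rs : List R, IsWeaklyRegular (LocalizedModule p.primeCompl M) rs ∧
      (∀ x ∈ rs, x ∈ p) ∧ rs.length = n := by
  obtain ⟨rs', hrs', hm, hlen⟩ := exists_isWeaklyRegular_of_le_localDepth (hn.trans (hM p))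
  have hnum (x : Localization.AtPrime p) :
      ∃ a : R, Associated x (algebraMap R (Localization.AtPrime p) a) := by
    obtain ⟨⟨a, s⟩, hs⟩ := IsLocalization.surj p.primeCompl x
    exact ⟨a, (IsLocalization.map_units _ s).unit, hs⟩
  choose num hassoc using hnum
  refine ⟨rs'.map num, ?_, fun y hy ↦ ?_, by simpa using hlen⟩
  · rw [← isWeaklyRegular_map_algebraMap_iff (Localization.AtPrime p), List.map_map]
    exact isWeaklyRegular_of_forall₂_associated
      (List.forall₂_map_right_iff.mpr (List.forall₂_same.mpr fun x _ ↦ hassoc x)) hrs'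
  · obtain ⟨x, hx, rfl⟩ := List.mem_map.mp hy
    rw [← IsLocalization.AtPrime.to_map_mem_maximal_iff (Localization.AtPrime p) p]
    exact Ideal.mem_of_dvd _ (hassoc x).dvd (hm x hx)

theorem exists_isPrime_forall_mem_iff_smul_eq_zero [IsNoetherianRing R] {L : Type*}
    [AddCommGroup L] [Module R L] {x : L} (hx : x ≠ 0) :
    ∃ (p : Ideal R) (_ : p.IsPrime) (c : R), (∀ a : R, a • x = 0 → a ∈ p) ∧
      ∀ a : R, a ∈ p ↔ a • c • x = 0 := by
  have hx' : (⟨x, Submodule.mem_span_singleton_self x⟩ : Submodule.span R {x}) ≠ 0 := by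
    simpa using hx
  obtain ⟨p, hp, hle⟩ := exists_le_isAssociatedPrime_of_isNoetherianRing R _ hx'
  obtain ⟨hpp, ⟨y, hy⟩, hpy⟩ := isAssociatedPrime_iff.mp hp
  obtain ⟨c, rfl⟩ := Submodule.mem_span_singleton.mp hy
  refine ⟨p, hpp, c, fun a ha ↦ hle ?_, fun a ↦ ?_⟩
  · simpa [Submodule.mem_colon_singleton] using ha
  · simp [hpy, Submodule.mem_colon_singleton]

theorem exists_notMem_smul_eq_zero {p : Ideal R} [p.IsPrime] {m : M}
    (h : LocalizedModule.mkLinearMap p.primeCompl M m = 0) : ∃ v ∉ p, v • m = 0 :=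
  LocalizedModule.mem_ker_mkLinearMap_iff.mp h

theorem IsMCM.isTorsionFree [IsDomain R] [IsNoetherianRing R] (hM : IsMCM R M) :
    Module.IsTorsionFree R M := by
  rw [Module.isTorsionFree_iff_smul_eq_zero]
  intro r x hrx
  by_contra! hne
  obtain ⟨hr, hx⟩ := hne
  obtain ⟨p, hp, c, hann, hmem⟩ := exists_isPrime_forall_mem_iff_smul_eq_zero (R := R) hx
  have hheight : ((1 : ℕ) : ℕ∞) ≤ p.height := by
    rw [Nat.cast_one, Order.one_le_iff_ne_zero, Ne, Ideal.height_eq_zero_iff_eq_bot]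
    rintro rfl
    exact hr (hann r hrx)
  obtain ⟨rs, hrs, hrsp, hlen⟩ := hM.exists_isWeaklyRegular p hheight
  obtain ⟨a, rfl⟩ := List.length_eq_one_iff.mp hlen
  obtain ⟨v, hv, hvx⟩ := exists_notMem_smul_eq_zero (p := p) (m := c • x) <|
    ((isWeaklyRegular_cons_iff _ a []).mp hrs).1.right_eq_zero_of_smul <| by
      rw [← map_smul, (hmem a).mp (hrsp a (by simp)), map_zero]
  exact hv ((hmem v).mpr hvx)

section Codimension

variable [IsDomain R] {V : Type*} [AddCommGroup V] [Module R V] [Module.IsTorsionFree R V]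
  {g : M →ₗ[R] V} {p : Ideal R} [p.IsPrime] {a b : R} {y : V}

theorem exists_notMem_smul_mem_range_of_isSMulRegular_zero
    (h : IsSMulRegular (LocalizedModule p.primeCompl M) (0 : R)) (hb : b ≠ 0)
    (hby : b • y ∈ LinearMap.range g) : ∃ v ∉ p, v • y ∈ LinearMap.range g := by
  obtain ⟨m, hm⟩ := hby
  obtain ⟨v, hv, hvm⟩ := exists_notMem_smul_eq_zero (p := p) (m := m)
    (h.right_eq_zero_of_smul (zero_smul R _))
  have hvy : v • y = 0 := by
    refine (smul_eq_zero_iff_right hb).mp ?_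
    rw [smul_comm, ← hm, ← map_smul, hvm, map_zero]
  exact ⟨v, hv, hvy ▸ zero_mem _⟩

/-- Write `a • y = g m` and `b • y = g m'`. Then `b • m = a • m'`, so `m` is divisible by `a`
after localization, which makes `y` itself a local section of the image. -/
theorem exists_notMem_smul_mem_range_of_isWeaklyRegular (hg : Function.Injective g)
    (h : IsWeaklyRegular (LocalizedModule p.primeCompl M) [a, b]) (ha : a ≠ 0)
    (hay : a • y ∈ LinearMap.range g) (hby : b • y ∈ LinearMap.range g) :
    ∃ v ∉ p, v • y ∈ LinearMap.range g := by
  obtain ⟨m, hm⟩ := hay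
  obtain ⟨m', hm'⟩ := hby
  have hmm' : b • m = a • m' := hg (by rw [map_smul, map_smul, hm, hm', smul_comm])
  simp only [isWeaklyRegular_cons_iff] at h
  have hdvd : LocalizedModule.mkLinearMap p.primeCompl M m ∈
      a • (⊤ : Submodule R (LocalizedModule p.primeCompl M)) := by
    refine mem_of_isSMulRegular_quotient_of_smul_mem h.2.1 ?_
    rw [← map_smul, hmm', map_smul]
    exact Submodule.smul_mem_pointwise_smul _ _ _ trivial
  obtain ⟨w, -, hw⟩ := (Submodule.mem_smul_pointwise_iff_exists _ _ _).mp hdvd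
  obtain ⟨⟨z, s⟩, hz⟩ := IsLocalizedModule.surj p.primeCompl
    (LocalizedModule.mkLinearMap p.primeCompl M) w
  obtain ⟨v, hv, hvz⟩ := exists_notMem_smul_eq_zero (p := p) (m := (s : R) • m - a • z) <| by
    rw [map_sub, map_smul, map_smul, ← hw, ← hz, Submonoid.smul_def, smul_comm, sub_self]
  refine ⟨v * s, p.primeCompl.mul_mem hv s.2, v • z, ?_⟩
  refine smul_right_injective V ha ?_
  change a • g (v • z) = a • (v * (s : R)) • y
  rw [smul_sub, sub_eq_zero] at hvz
  rw [← map_smul, smul_comm a v z, ← hvz, map_smul, map_smul, hm, mul_smul, smul_comm a v,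
    smul_comm a (s : R)]

theorem mem_range_of_isMCM [IsNoetherianRing R] (hM : IsMCM R M) (hg : Function.Injective g)
    {x : V} (hx : ∀ (p : Ideal R) [p.IsPrime], p.height ≤ 1 → ∃ t ∉ p, t • x ∈ LinearMap.range g) :
    x ∈ LinearMap.range g := by
  by_contra hne
  have hx0 : (LinearMap.range g).mkQ x ≠ 0 := by simpa using hne
  obtain ⟨p, hp, c, -, hmem⟩ := exists_isPrime_forall_mem_iff_smul_eq_zero (R := R) hx0
  replace hmem (a : R) : a ∈ p ↔ a • c • x ∈ LinearMap.range g := by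
    rw [hmem, ← map_smul, ← map_smul, Submodule.mkQ_apply, Submodule.Quotient.mk_eq_zero]
  have hheight : ((2 : ℕ) : ℕ∞) ≤ p.height := by
    by_contra! hlt
    obtain ⟨t, ht, htx⟩ := hx p (Order.le_of_lt_succ hlt)
    exact ht ((hmem t).mpr (smul_comm t c x ▸ Submodule.smul_mem _ c htx))
  obtain ⟨rs, hrs, hrsp, hlen⟩ := hM.exists_isWeaklyRegular p hheight
  obtain ⟨a, b, rfl⟩ := List.length_eq_two.mp hlen
  have hab (r : R) (hr : r ∈ [a, b]) : r • c • x ∈ LinearMap.range g := (hmem r).mp (hrsp r hr)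
  suffices h : ∃ v ∉ p, v • c • x ∈ LinearMap.range g by
    obtain ⟨v, hv, hvx⟩ := h
    exact hv ((hmem v).mpr hvx)
  by_cases ha : a = 0
  · have hpbot : p ≠ ⊥ := fun h ↦ by simp [h] at hheight
    obtain ⟨d, hd, hd0⟩ := Submodule.exists_mem_ne_zero_of_ne_bot hpbot
    subst ha
    exact exists_notMem_smul_mem_range_of_isSMulRegular_zero
      ((isWeaklyRegular_cons_iff _ _ _).mp hrs).1 hd0 ((hmem d).mp hd)
  · exact exists_notMem_smul_mem_range_of_isWeaklyRegular hg hrs ha (hab a (by simp))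
      (hab b (by simp))

end Codimension

end Localization

/-! ### Lengths at primes of height one -/

section Classes

variable {R : Type u} [CommRing R]

theorem H.cls_eq_add_of_exact {M₁ M₂ M₃ : FGModuleCat.{u} R} (f : M₁ →ₗ[R] M₂) (g : M₂ →ₗ[R] M₃)
    (hf : Function.Injective f) (hfg : Function.Exact f g) (hg : Function.Surjective g) :
    H.cls M₂ = H.cls M₁ + H.cls M₃ := by
  have h : G.cls M₂ = G.cls M₁ + G.cls M₃ := by
    rw [← sub_eq_zero, ← sub_sub]
    exact (QuotientAddGroup.eq_zero_iff _).mpr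
      (AddSubgroup.subset_closure ⟨M₁, M₂, M₃, f, g, hf, hfg, hg, rfl⟩)
  exact congr_arg (QuotientAddGroup.mk (s := AddSubgroup.closure _)) h

theorem H.cls_eq_zero {M : FGModuleCat.{u} R} (h : IsPseudoZero R M) : H.cls M = 0 :=
  (QuotientAddGroup.eq_zero_iff _).mpr (AddSubgroup.subset_closure ⟨M, h, rfl⟩)

theorem isPseudoZero_of_subsingleton {M : Type u} [AddCommGroup M] [Module R M] [Subsingleton M] :
    IsPseudoZero R M :=
  fun p _ _ ↦ LocalizedModule.subsingleton_iff.mpr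
    fun _ ↦ ⟨1, p.primeCompl.one_mem, Subsingleton.elim _ _⟩

theorem H.cls_congr {M N : FGModuleCat.{u} R} (e : M ≃ₗ[R] N) : H.cls M = H.cls N := by
  have h := H.cls_eq_add_of_exact (M₃ := FGModuleCat.of R PUnit.{u + 1}) e.toLinearMap 0 e.injective
    ((LinearMap.exact_zero_iff_surjective _ _).mpr e.surjective) (fun _ ↦ ⟨0, rfl⟩)
  rwa [H.cls_eq_zero (M := FGModuleCat.of R PUnit.{u + 1})
    (isPseudoZero_of_subsingleton (M := PUnit.{u + 1})), add_zero, eq_comm] at h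

theorem H.cls_pi (M : Type u) [AddCommGroup M] [Module R M] [Module.Finite R M] (n : ℕ) :
    H.cls (FGModuleCat.of R (Fin n → M)) = n • H.cls (FGModuleCat.of R M) := by
  induction n with
  | zero =>
    rw [zero_nsmul]
    exact H.cls_eq_zero (isPseudoZero_of_subsingleton (M := Fin 0 → M))
  | succ n ih =>
    let e : (Fin (n + 1) → M) ≃ₗ[R] M × (Fin n → M) := (Fin.consLinearEquiv R fun _ ↦ M).symm
    rw [H.cls_congr (N := FGModuleCat.of R (M × (Fin n → M))) e,
      H.cls_eq_add_of_exact (M₁ := FGModuleCat.of R M) (M₃ := FGModuleCat.of R (Fin n → M))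
        (LinearMap.inl R M (Fin n → M)) (LinearMap.snd R M (Fin n → M)) LinearMap.inl_injective
        .inl_snd LinearMap.snd_surjective, ih, succ_nsmul']

end Classes

section Length

variable {R : Type u} [CommRing R]

/-- The length of the localization of a module at a prime. -/
def lengthAt (p : Ideal R) [p.IsPrime] (M : Type u) [AddCommGroup M] [Module R M] : ℕ∞ :=
  Module.length (Localization.AtPrime p) (LocalizedModule p.primeCompl M)

variable (p : Ideal R) [p.IsPrime]
variable {M N P : Type u} [AddCommGroup M] [Module R M] [AddCommGroup N] [Module R N]
  [AddCommGroup P] [Module R P]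

theorem lengthAt_eq_add_of_exact {f : M →ₗ[R] N} {g : N →ₗ[R] P} (hf : Function.Injective f)
    (hfg : Function.Exact f g) (hg : Function.Surjective g) :
    lengthAt p N = lengthAt p M + lengthAt p P :=
  Module.length_eq_add_of_exact (LocalizedModule.map p.primeCompl f)
    (LocalizedModule.map p.primeCompl g) (LocalizedModule.map_injective _ f hf)
    (LocalizedModule.map_surjective _ g hg) (LocalizedModule.map_exact _ f g hfg)

theorem lengthAt_eq_zero_iff : lengthAt p M = 0 ↔ ∀ m : M, ∃ t ∉ p, t • m = 0 := by
  rw [lengthAt, Module.length_eq_zero_iff, LocalizedModule.subsingleton_iff]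
  rfl

theorem isPseudoZero_iff_lengthAt_eq_zero :
    IsPseudoZero R M ↔ ∀ (p : Ideal R) [p.IsPrime], p.height ≤ 1 → lengthAt p M = 0 :=
  forall₃_congr fun _ _ _ ↦ Module.length_eq_zero_iff.symm

theorem lengthAt_congr (e : M ≃ₗ[R] N) : lengthAt p M = lengthAt p N := by
  have h := lengthAt_eq_add_of_exact p (f := e.toLinearMap) (g := (0 : N →ₗ[R] PUnit.{u + 1}))
    e.injective ((LinearMap.exact_zero_iff_surjective _ _).mpr e.surjective) fun _ ↦ ⟨0, rfl⟩
  rwa [(lengthAt_eq_zero_iff p (M := PUnit.{u + 1})).mpr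
    fun _ ↦ ⟨1, Ideal.one_notMem p, rfl⟩, add_zero, eq_comm] at h

theorem lengthAt_quotient {N' : Type*} [AddCommGroup N'] [Module R N']
    [Module (Localization.AtPrime p) N'] [IsScalarTower R (Localization.AtPrime p) N']
    (i : N →ₗ[R] N') [IsLocalizedModule p.primeCompl i] (L : Submodule R N) :
    lengthAt p (N ⧸ L) = Module.length (Localization.AtPrime p)
      (N' ⧸ L.localized' (Localization.AtPrime p) p.primeCompl i) :=
  ((IsLocalizedModule.linearEquiv p.primeCompl (LocalizedModule.mkLinearMap p.primeCompl (N ⧸ L))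
    (L.toLocalizedQuotient' (Localization.AtPrime p) p.primeCompl i)).extendScalarsOfIsLocalization
      p.primeCompl (Localization.AtPrime p)).length_eq

theorem lengthAt_quotient_self : lengthAt p (R ⧸ p) = 1 := by
  have h : p.localized' (Localization.AtPrime p) p.primeCompl
      (Algebra.linearMap R (Localization.AtPrime p)) =
      IsLocalRing.maximalIdeal (Localization.AtPrime p) := by
    rw [Submodule.localized'_eq_span, ← Localization.AtPrime.map_eq_maximalIdeal]
    rfl
  rw [lengthAt_quotient p (Algebra.linearMap R (Localization.AtPrime p)), h,
    Module.length_eq_one_iff, isSimpleModule_iff_isCoatom]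
  exact (IsLocalRing.maximalIdeal.isMaximal _).out

theorem lengthAt_quotient_eq_zero_of_not_le {q : Ideal R} (h : ¬ q ≤ p) :
    lengthAt p (R ⧸ q) = 0 := by
  obtain ⟨t, htq, htp⟩ := SetLike.not_le_iff_exists.mp h
  refine (lengthAt_eq_zero_iff p).mpr fun m ↦ ⟨t, htp, ?_⟩
  rw [Algebra.smul_def, Ideal.Quotient.algebraMap_eq, Ideal.Quotient.eq_zero_iff_mem.mpr htq,
    zero_mul]

theorem isPseudoZero_quotient {q : Ideal R} (hq : 1 < q.height) : IsPseudoZero R (R ⧸ q) :=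
  isPseudoZero_iff_lengthAt_eq_zero.mpr fun p _ hp ↦
    lengthAt_quotient_eq_zero_of_not_le p fun hle ↦ (hq.trans_le (Ideal.height_mono hle)).not_ge hp

theorem lengthAt_quotient_range {M' N' : Type*} [AddCommGroup M'] [Module R M']
    [Module (Localization.AtPrime p) M'] [IsScalarTower R (Localization.AtPrime p) M']
    [AddCommGroup N'] [Module R N']
    [Module (Localization.AtPrime p) N'] [IsScalarTower R (Localization.AtPrime p) N']
    (i : M →ₗ[R] M') [IsLocalizedModule p.primeCompl i]
    (j : N →ₗ[R] N') [IsLocalizedModule p.primeCompl j] {f : M →ₗ[R] N}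
    {f' : M' →ₗ[Localization.AtPrime p] N'} (h : ∀ m, f' (i m) = j (f m)) :
    lengthAt p (N ⧸ LinearMap.range f) =
      Module.length (Localization.AtPrime p) (N' ⧸ LinearMap.range f') := by
  rw [lengthAt_quotient p j]
  have hf' : f' = (IsLocalizedModule.map p.primeCompl i j f).extendScalarsOfIsLocalization
      p.primeCompl (Localization.AtPrime p) := by
    apply LinearMap.restrictScalars_injective R
    refine IsLocalizedModule.ext p.primeCompl i (IsLocalizedModule.map_units j) ?_
    ext m
    simp [h]
  rw [hf', LinearMap.localized'_range_eq_range_localizedMap (Localization.AtPrime p) p.primeCompl i]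

section Determinant

theorem det_localizedModule_map [Module.Free R M] [Module.Finite R M] (S : Submonoid R)
    (f : M →ₗ[R] M) :
    LinearMap.det (LocalizedModule.map S f) = algebraMap R (Localization S) (LinearMap.det f) := by
  have hi := IsLocalizedModule.isBaseChange S (Localization S) (LocalizedModule.mkLinearMap S M)
  have hf : LocalizedModule.map S f = hi.endHom f := hi.algHom_ext _ _ fun m ↦ by
    rw [hi.endHom_comp_apply]
    simp
  rw [hf, hi.det_endHom]

variable {B F : Type*} [CommRing B] [IsDomain B] [AddCommGroup F] [Module B F]

theorem det_ne_zero_of_injective [Module.Free B F] [Module.Finite B F] {f : F →ₗ[B] F}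
    (hf : Function.Injective f) : LinearMap.det f ≠ 0 :=
  fun h ↦ LinearMap.det_eq_zero_iff_ker_ne_bot.mp h (LinearMap.ker_eq_bot.mpr hf)

theorem ord_prod {ι : Type*} (s : Finset ι) {a : ι → B} (ha : ∀ i ∈ s, a i ≠ 0) :
    Ring.ord B (∏ i ∈ s, a i) = ∑ i ∈ s, Ring.ord B (a i) := by
  classical
  induction s using Finset.induction_on with
  | empty => simp
  | insert i s hi ih =>
    have hs : ∀ j ∈ s, a j ≠ 0 := fun j hj ↦ ha j (Finset.mem_insert_of_mem hj)
    rw [Finset.prod_insert hi, Finset.sum_insert hi,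
      Ring.ord_mul B (mem_nonZeroDivisors_of_ne_zero (Finset.prod_ne_zero_iff.mpr hs)), ih hs]

variable [IsPrincipalIdealRing B]

theorem associated_det_prod_smithNormalFormCoeffs {ι : Type*} [Fintype ι] (b : Module.Basis ι B F)
    {f : F →ₗ[B] F} (hf : Function.Injective f) :
    Associated (LinearMap.det f)
      (∏ i, Submodule.smithNormalFormCoeffs b (LinearMap.finrank_range_of_inj hf) i) := by
  classical
  have hrank := LinearMap.finrank_range_of_inj hf
  let b' := Submodule.smithNormalFormTopBasis b hrank
  let e : F ≃ₗ[B] LinearMap.range f :=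
    b'.equiv (Submodule.smithNormalFormBotBasis b hrank) (Equiv.refl _)
  have hdiag : Matrix.toLin b' b' (Matrix.diagonal (Submodule.smithNormalFormCoeffs b hrank)) =
      (LinearMap.range f).subtype ∘ₗ e.toLinearMap :=
    b'.ext fun i ↦ by
      simp [Matrix.toLin_apply, Finsupp.single_eq_pi_single, Pi.single_apply, e, b']
  rw [← Matrix.det_diagonal, ← LinearMap.det_toLin b', hdiag]
  exact LinearMap.associated_det_comp_equiv (LinearMap.range f).subtype
    (LinearEquiv.ofInjective f hf) e

theorem length_quotient_range_eq_ord_det [Module.Free B F] [Module.Finite B F] {f : F →ₗ[B] F}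
    (hf : Function.Injective f) :
    Module.length B (F ⧸ LinearMap.range f) = Ring.ord B (LinearMap.det f) := by
  let b := Module.Free.chooseBasis B F
  have hrank := LinearMap.finrank_range_of_inj hf
  rw [(Submodule.quotientEquivPiSpan (LinearMap.range f) b hrank).length_eq,
    Module.length_pi_of_fintype,
    Ring.ord_eq_of_associated (associated_det_prod_smithNormalFormCoeffs b hf),
    ord_prod _ fun i _ ↦ Submodule.smithNormalFormCoeffs_ne_zero b hrank i]
  rfl

theorem lengthAt_quotient_range_eq_ord_det [IsDomain R]
    [IsDiscreteValuationRing (Localization.AtPrime p)] [Module.Free R M] [Module.Finite R M]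
    {f : M →ₗ[R] M} (hf : Function.Injective f) :
    lengthAt p (M ⧸ LinearMap.range f) =
      Ring.ord (Localization.AtPrime p) (algebraMap R _ (LinearMap.det f)) := by
  rw [lengthAt_quotient_range p (LocalizedModule.mkLinearMap p.primeCompl M)
    (LocalizedModule.mkLinearMap p.primeCompl M) (f' := LocalizedModule.map p.primeCompl f)
    (fun x ↦ by simp), length_quotient_range_eq_ord_det
    (LocalizedModule.map_injective p.primeCompl f hf), det_localizedModule_map]

end Determinant

/-- The primes of height one, indexing the prime divisors of `R`. -/
abbrev HeightOne (R : Type u) [CommRing R] : Type u := {p : Ideal R // p.IsPrime ∧ p.height = 1}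

instance (p : HeightOne R) : p.1.IsPrime := p.2.1

variable (R M) in
/-- The divisor `L` is the cycle of `M` in codimension one: it records the lengths of `M` at the
primes of height one, and it represents the class of `M` in `H(R)`. -/
structure HasCycle [Module.Finite R M] (L : HeightOne R →₀ ℕ) : Prop where
  lengthAt_eq : ∀ p : HeightOne R, lengthAt p.1 M = L p
  cls_eq : H.cls (FGModuleCat.of R M) = L.sum fun p n ↦ n • H.cls (FGModuleCat.of R (R ⧸ p.1))

section Cycle

variable [Module.Finite R M] [Module.Finite R N] [Module.Finite R P]

theorem HasCycle.congr {L : HeightOne R →₀ ℕ} (e : M ≃ₗ[R] N) (h : HasCycle R N L) :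
    HasCycle R M L where
  lengthAt_eq p := (lengthAt_congr p.1 e).trans (h.lengthAt_eq p)
  cls_eq := (H.cls_congr (M := FGModuleCat.of R M) (N := FGModuleCat.of R N) e).trans h.cls_eq

theorem IsPseudoZero.hasCycle (h : IsPseudoZero R M) : HasCycle R M 0 where
  lengthAt_eq p := isPseudoZero_iff_lengthAt_eq_zero.mp h p.1 p.2.2.le
  cls_eq := (H.cls_eq_zero (M := FGModuleCat.of R M) h).trans Finsupp.sum_zero_index.symm

theorem hasCycle_quotient (q : HeightOne R) : HasCycle R (R ⧸ q.1) (Finsupp.single q 1) where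
  lengthAt_eq p := by
    classical
    rw [Finsupp.single_apply]
    split_ifs with hqp
    · rw [← hqp, lengthAt_quotient_self, Nat.cast_one]
    · rw [Nat.cast_zero]
      refine lengthAt_quotient_eq_zero_of_not_le p.1 fun hle ↦ ?_
      have := (p.1.finiteHeight_iff).mpr (Or.inr (by simp [p.2.2]))
      have hlt := Ideal.height_strict_mono_of_isPrime_of_isPrime
        (lt_of_le_of_ne hle (Subtype.coe_injective.ne hqp))
      rw [p.2.2, q.2.2] at hlt
      exact hlt.false
  cls_eq := by
    rw [Finsupp.sum_single_index
      (h := fun (p : HeightOne R) n ↦ n • H.cls (FGModuleCat.of R (R ⧸ p.1))) (zero_nsmul _),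
      one_nsmul]

theorem HasCycle.add {L₁ L₃ : HeightOne R →₀ ℕ} {f : M →ₗ[R] N} {g : N →ₗ[R] P}
    (hf : Function.Injective f) (hfg : Function.Exact f g) (hg : Function.Surjective g)
    (h₁ : HasCycle R M L₁) (h₃ : HasCycle R P L₃) : HasCycle R N (L₁ + L₃) where
  lengthAt_eq p := by
    rw [lengthAt_eq_add_of_exact p.1 hf hfg hg, h₁.lengthAt_eq, h₃.lengthAt_eq, Finsupp.add_apply,
      Nat.cast_add]
  cls_eq := by
    classical
    rw [Finsupp.sum_add_index'
      (h := fun (p : HeightOne R) n ↦ n • H.cls (FGModuleCat.of R (R ⧸ p.1)))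
      (fun _ ↦ zero_nsmul _) (fun _ _ _ ↦ add_nsmul _ _ _), ← h₁.cls_eq, ← h₃.cls_eq]
    exact H.cls_eq_add_of_exact (M₁ := FGModuleCat.of R M) (M₂ := FGModuleCat.of R N)
      (M₃ := FGModuleCat.of R P) f g hf hfg hg

variable [IsDomain R] [IsNoetherianRing R]

theorem exists_hasCycle (h : Module.finrank R M = 0) : ∃ L, HasCycle R M L := by
  induction ‹Module.Finite R M› using
    IsNoetherianRing.induction_on_isQuotientEquivQuotientPrime R with
  | subsingleton N => exact ⟨0, isPseudoZero_of_subsingleton.hasCycle⟩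
  | quotient N q e =>
    have hq : 0 < q.1.height := by
      rw [pos_iff_ne_zero, Ne, Ideal.height_eq_zero_iff_eq_bot]
      intro hbot
      obtain ⟨a, ha, ha1⟩ := Module.finrank_eq_zero_iff.mp (e.finrank_eq.symm.trans h) 1
      rw [Algebra.smul_def, mul_one, Ideal.Quotient.algebraMap_eq, Ideal.Quotient.eq_zero_iff_mem,
        hbot] at ha1
      exact ha ha1
    obtain h1 | h1 := (Order.one_le_iff_pos.mpr hq).eq_or_lt
    · exact ⟨_, (hasCycle_quotient ⟨q.1, q.2, h1.symm⟩).congr e⟩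
    · exact ⟨0, (isPseudoZero_quotient h1).hasCycle.congr e⟩
  | exact N₁ N₂ N₃ f g hf hg hfg h₁ h₃ =>
    have hrank : Module.finrank R N₂ = Module.finrank R N₁ + Module.finrank R N₃ :=
      finrank_exact R (M₁ := FGModuleCat.of R N₁) (M₂ := FGModuleCat.of R N₂)
        (M₃ := FGModuleCat.of R N₃) hf hfg hg
    obtain ⟨L₁, hL₁⟩ := h₁ (by omega)
    obtain ⟨L₃, hL₃⟩ := h₃ (by omega)
    exact ⟨L₁ + L₃, hL₁.add hf hfg hg hL₃⟩

theorem lengthAt_ne_top (h : Module.finrank R M = 0) (p : HeightOne R) : lengthAt p.1 M ≠ ⊤ := by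
  obtain ⟨L, hL⟩ := exists_hasCycle h
  simp [hL.lengthAt_eq]

theorem H.cls_eq_of_lengthAt_eq (hM : Module.finrank R M = 0) (hN : Module.finrank R N = 0)
    (h : ∀ p : HeightOne R, lengthAt p.1 M = lengthAt p.1 N) :
    H.cls (FGModuleCat.of R M) = H.cls (FGModuleCat.of R N) := by
  obtain ⟨L, hL⟩ := exists_hasCycle hM
  obtain ⟨L', hL'⟩ := exists_hasCycle hN
  have hLL' : L = L' := by
    ext p
    exact_mod_cast (hL.lengthAt_eq p).symm.trans ((h p).trans (hL'.lengthAt_eq p))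
  rw [hL.cls_eq, hL'.cls_eq, hLL']

end Cycle

end Length

/-! ### Lattices and divisor classes -/

section Lattice

variable {R : Type u} [CommRing R]
variable {M N P : Type u} [AddCommGroup M] [Module R M] [AddCommGroup N] [Module R N]
  [AddCommGroup P] [Module R P]

/-- The map `v` embeds `M` as a submodule of full rank in `N`; over a domain this says that `v` is
injective with torsion cokernel. -/
structure IsLattice (v : M →ₗ[R] N) : Prop where
  injective : Function.Injective v
  finrank_eq : Module.finrank R M = Module.finrank R N

theorem IsLattice.comp {v : M →ₗ[R] N} {w : N →ₗ[R] P} (hw : IsLattice w) (hv : IsLattice v) :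
    IsLattice (w ∘ₗ v) :=
  ⟨hw.injective.comp hv.injective, hv.finrank_eq.trans hw.finrank_eq⟩

theorem isLattice_smul_id [IsDomain R] [Module.IsTorsionFree R M] {a : R} (ha : a ≠ 0) :
    IsLattice (a • LinearMap.id : M →ₗ[R] M) :=
  ⟨smul_right_injective M ha, rfl⟩

variable (R M) in
theorem exists_isLattice [IsDomain R] :
    ∃ v : (Fin (Module.finrank R M) → R) →ₗ[R] M, IsLattice v := by
  obtain ⟨f, hf⟩ := exists_linearIndependent_of_le_finrank (R := R) (M := M) le_rfl
  exact ⟨Fintype.linearCombination R f, hf.fintypeLinearCombination_injective,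
    Module.finrank_fin_fun R⟩

section Cokernel

variable [IsDomain R] [Module.Finite R N] {v : M →ₗ[R] N} (hv : IsLattice v)

include hv

theorem IsLattice.finrank_quotient_range : Module.finrank R (N ⧸ LinearMap.range v) = 0 := by
  have h := Submodule.finrank_quotient_add_finrank (LinearMap.range v)
  rw [LinearMap.finrank_range_of_inj hv.injective, hv.finrank_eq] at h
  omega

theorem IsLattice.exists_smul_mem : ∃ a : R, a ≠ 0 ∧ ∀ x, a • x ∈ LinearMap.range v := by
  obtain ⟨a, ha, ha'⟩ := Submodule.annihilator_top_inter_nonZeroDivisors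
    (Module.finrank_eq_zero_iff_isTorsion.mp hv.finrank_quotient_range)
  refine ⟨a, nonZeroDivisors.ne_zero ha', fun x ↦ ?_⟩
  rw [← Submodule.Quotient.mk_eq_zero, Submodule.Quotient.mk_smul]
  exact Submodule.mem_annihilator.mp ha _ trivial

theorem IsLattice.lengthAt_ne_top [IsNoetherianRing R] (p : HeightOne R) :
    lengthAt p.1 (N ⧸ LinearMap.range v) ≠ ⊤ :=
  CMCone.lengthAt_ne_top hv.finrank_quotient_range p

end Cokernel

theorem lengthAt_quotient_eq_add (p : Ideal R) [p.IsPrime] {f : M →ₗ[R] N} {g : N →ₗ[R] P}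
    (hfg : Function.Exact f g) (hg : Function.Surjective g) (L : Submodule R N) :
    lengthAt p (N ⧸ L) = lengthAt p (M ⧸ L.comap f) + lengthAt p (P ⧸ L.map g) := by
  refine lengthAt_eq_add_of_exact p (f := Submodule.mapQ _ L f le_rfl)
    (g := Submodule.mapQ L _ g (Submodule.le_comap_map g L)) ?_ ?_ ?_
  · rw [← LinearMap.ker_eq_bot, Submodule.ker_mapQ, Submodule.mkQ_map_self]
  · intro y
    obtain ⟨y, rfl⟩ := Submodule.Quotient.mk_surjective _ y
    rw [Submodule.mapQ_apply, Submodule.Quotient.mk_eq_zero]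
    constructor
    · rintro ⟨l, hl, hly⟩
      obtain ⟨x, hx⟩ := (hfg (y - l)).mp (by rw [map_sub, hly, sub_self])
      refine ⟨Submodule.Quotient.mk x, ?_⟩
      rw [Submodule.mapQ_apply, Submodule.Quotient.eq, hx, sub_sub_cancel_left]
      exact L.neg_mem hl
    · rintro ⟨x, hx⟩
      obtain ⟨x, rfl⟩ := Submodule.Quotient.mk_surjective _ x
      rw [Submodule.mapQ_apply, Submodule.Quotient.eq] at hx
      have h := (L.map g).neg_mem (Submodule.mem_map_of_mem (f := g) hx)
      rwa [map_sub, hfg.apply_apply_eq_zero, zero_sub, neg_neg] at h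
  · intro z
    obtain ⟨z, rfl⟩ := Submodule.Quotient.mk_surjective _ z
    obtain ⟨y, rfl⟩ := hg z
    exact ⟨Submodule.Quotient.mk y, rfl⟩

theorem lengthAt_quotient_range_comp (p : Ideal R) [p.IsPrime] (v : M →ₗ[R] N) {w : N →ₗ[R] P}
    (hw : Function.Injective w) :
    lengthAt p (P ⧸ LinearMap.range (w ∘ₗ v)) =
      lengthAt p (N ⧸ LinearMap.range v) + lengthAt p (P ⧸ LinearMap.range w) := by
  have hcomap : (LinearMap.range (w ∘ₗ v)).comap w = LinearMap.range v := by
    rw [LinearMap.range_comp, Submodule.comap_map_eq_of_injective hw]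
  have hmap : (LinearMap.range (w ∘ₗ v)).map (LinearMap.range w).mkQ = ⊥ := by
    rw [← LinearMap.le_ker_iff_map, Submodule.ker_mkQ]
    exact LinearMap.range_comp_le_range v w
  rw [lengthAt_quotient_eq_add p (LinearMap.exact_map_mkQ_range w) (Submodule.mkQ_surjective _),
    hcomap, lengthAt_congr p (Submodule.quotEquivOfEqBot _ hmap)]

theorem exists_comp_eq_of_forall_mem_range {v : M →ₗ[R] N} (hv : Function.Injective v)
    (f : P →ₗ[R] N) (hf : ∀ x, f x ∈ LinearMap.range v) : ∃ g : P →ₗ[R] M, v ∘ₗ g = f := by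
  refine ⟨(LinearEquiv.ofInjective v hv).symm.toLinearMap ∘ₗ f.codRestrict _ hf, ?_⟩
  ext x
  exact congr_arg Subtype.val ((LinearEquiv.ofInjective v hv).apply_symm_apply ⟨f x, hf x⟩)

theorem IsLattice.exists_ord_add_lengthAt_eq [IsDomain R] [IsNoetherianRing R]
    [IsIntegrallyClosed R] [Module.Finite R M] {F F' : Type u} [AddCommGroup F] [Module R F]
    [AddCommGroup F'] [Module R F'] [Module.Free R F] [Module.Finite R F] [Module.Free R F']
    [Module.Finite R F'] {v : F →ₗ[R] M} {v' : F' →ₗ[R] M} (hv : IsLattice v)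
    (hv' : IsLattice v') :
    ∃ a b : R, a ≠ 0 ∧ b ≠ 0 ∧ ∀ p : HeightOne R,
      Ring.ord (Localization.AtPrime p.1) (algebraMap R _ a) +
          lengthAt p.1 (M ⧸ LinearMap.range v) =
        Ring.ord (Localization.AtPrime p.1) (algebraMap R _ b) +
          lengthAt p.1 (M ⧸ LinearMap.range v') := by
  obtain ⟨c, hc, hcv⟩ := hv.exists_smul_mem
  let e : F ≃ₗ[R] F' := LinearEquiv.ofFinrankEq _ _ (hv.finrank_eq.trans hv'.finrank_eq.symm)
  let w : F →ₗ[R] M := v' ∘ₗ e.toLinearMap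
  have hw : Function.Injective w := hv'.injective.comp e.injective
  let s : F →ₗ[R] F := c • LinearMap.id
  have hs : Function.Injective s := smul_right_injective F hc
  obtain ⟨A, hA⟩ := exists_comp_eq_of_forall_mem_range hv.injective (w ∘ₗ s) fun x ↦ by
    simpa [w, s] using hcv (v' (e x))
  have hAinj : Function.Injective A :=
    .of_comp (f := v) (by rw [← LinearMap.coe_comp, hA]; exact hw.comp hs)
  refine ⟨_, _, det_ne_zero_of_injective hAinj, det_ne_zero_of_injective hs, fun p ↦ ?_⟩
  have := isDiscreteValuationRing_atPrime p.1 p.2.2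
  calc
    _ = lengthAt p.1 (M ⧸ LinearMap.range (v ∘ₗ A)) := by
      rw [lengthAt_quotient_range_comp p.1 A hv.injective,
        lengthAt_quotient_range_eq_ord_det _ hAinj]
    _ = lengthAt p.1 (M ⧸ LinearMap.range (w ∘ₗ s)) := by rw [hA]
    _ = _ := by
      rw [lengthAt_quotient_range_comp p.1 s hw, lengthAt_quotient_range_eq_ord_det _ hs,
        LinearMap.range_comp_of_range_eq_top v' e.range]

end Lattice

section DivisorClass

variable (R : Type u) [CommRing R]

variable {R} in
/-- The divisor of a nonzero element. -/
def divisorOf (a : R) : HeightOne R → ℤ :=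
  fun p ↦ ((Ring.ord (Localization.AtPrime p.1) (algebraMap R _ a)).toNat : ℤ)

variable [IsDomain R] [IsNoetherianRing R] [IsIntegrallyClosed R]

variable {R} in
theorem ord_algebraMap_ne_top {a : R} (ha : a ≠ 0) (p : HeightOne R) :
    Ring.ord (Localization.AtPrime p.1) (algebraMap R _ a) ≠ ⊤ := by
  have := isDiscreteValuationRing_atPrime p.1 p.2.2
  exact Ring.ord_ne_top (map_mem_nonZeroDivisors _
    (IsLocalization.injective _ p.1.primeCompl_le_nonZeroDivisors)
    (mem_nonZeroDivisors_of_ne_zero ha))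

variable {R} in
theorem divisorOf_mul {a b : R} (ha : a ≠ 0) (hb : b ≠ 0) :
    divisorOf (a * b) = divisorOf a + divisorOf b := by
  ext p
  have hb' : algebraMap R (Localization.AtPrime p.1) b ∈ nonZeroDivisors _ :=
    map_mem_nonZeroDivisors _ (IsLocalization.injective _ p.1.primeCompl_le_nonZeroDivisors)
      (mem_nonZeroDivisors_of_ne_zero hb)
  simp only [divisorOf, Pi.add_apply]
  rw [map_mul, Ring.ord_mul _ hb', ENat.toNat_add (ord_algebraMap_ne_top ha p)
    (ord_algebraMap_ne_top hb p), Nat.cast_add]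

/-- The group of principal divisors. -/
def principalDivisors : AddSubgroup (HeightOne R → ℤ) where
  carrier := {x | ∃ a b : R, a ≠ 0 ∧ b ≠ 0 ∧ x = divisorOf a - divisorOf b}
  zero_mem' := ⟨1, 1, one_ne_zero, one_ne_zero, by simp⟩
  add_mem' := by
    rintro _ _ ⟨a, b, ha, hb, rfl⟩ ⟨c, d, hc, hd, rfl⟩
    refine ⟨a * c, b * d, mul_ne_zero ha hc, mul_ne_zero hb hd, ?_⟩
    rw [divisorOf_mul ha hc, divisorOf_mul hb hd]
    abel
  neg_mem' := by
    rintro _ ⟨a, b, ha, hb, rfl⟩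
    exact ⟨b, a, hb, ha, by abel⟩

/-- Divisors modulo principal divisors. Divisors are not required to have finite support, so this
contains the divisor class group; the classes of modules lie in the latter. -/
abbrev DivisorClass : Type u := (HeightOne R → ℤ) ⧸ principalDivisors R

variable {R}
variable {M N P : Type u} [AddCommGroup M] [Module R M] [AddCommGroup N] [Module R N]
  [AddCommGroup P] [Module R P]

/-- The divisor of the cokernel of a lattice. -/
def colengthDivisor (v : M →ₗ[R] N) : HeightOne R → ℤ :=
  fun p ↦ ((lengthAt p.1 (N ⧸ LinearMap.range v)).toNat : ℤ)

variable (R M) in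
/-- The divisor class of a module `M`: that of `M ⧸ F` for a free lattice `F` in `M`. It does not
depend on `F` when `M` is finitely generated. -/
def divisorClass : DivisorClass R :=
  QuotientAddGroup.mk (colengthDivisor (exists_isLattice R M).choose)

theorem IsLattice.mk_colengthDivisor [Module.Finite R M] {F : Type u} [AddCommGroup F] [Module R F]
    [Module.Free R F] [Module.Finite R F] {v : F →ₗ[R] M} (hv : IsLattice v) :
    (QuotientAddGroup.mk (colengthDivisor v) : DivisorClass R) = divisorClass R M := by
  have hv' := (exists_isLattice R M).choose_spec
  obtain ⟨a, b, ha, hb, h⟩ := hv.exists_ord_add_lengthAt_eq hv'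
  refine QuotientAddGroup.eq.mpr ⟨a, b, ha, hb, ?_⟩
  ext p
  have hp := congr_arg ENat.toNat (h p)
  rw [ENat.toNat_add (ord_algebraMap_ne_top ha p) (hv.lengthAt_ne_top p),
    ENat.toNat_add (ord_algebraMap_ne_top hb p) (hv'.lengthAt_ne_top p)] at hp
  simp only [colengthDivisor, divisorOf, Pi.add_apply, Pi.neg_apply, Pi.sub_apply]
  omega

theorem divisorClass_eq_add_of_exact [Module.Finite R M] [Module.Finite R N] [Module.Finite R P]
    {f : M →ₗ[R] N} {g : N →ₗ[R] P} (hf : Function.Injective f) (hfg : Function.Exact f g)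
    (hg : Function.Surjective g) :
    divisorClass R N = divisorClass R M + divisorClass R P := by
  obtain ⟨v, hv⟩ := exists_isLattice R M
  obtain ⟨w, hw⟩ := exists_isLattice R P
  obtain ⟨s, hs⟩ := Module.projective_lifting_property g w hg
  let t : ((Fin (Module.finrank R M) → R) × (Fin (Module.finrank R P) → R)) →ₗ[R] N :=
    (f ∘ₗ v).coprod s
  have hgt : g ∘ₗ t = w ∘ₗ LinearMap.snd R _ _ := by
    rw [LinearMap.comp_coprod, ← LinearMap.comp_assoc, hfg.linearMap_comp_eq_zero,
      LinearMap.zero_comp, hs, LinearMap.coprod_zero_left]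
  have ht_mem (y) (m) (h : t y = f m) : v y.1 = m ∧ y.2 = 0 := by
    have hy : y.2 = 0 := hw.injective <| by
      rw [map_zero, ← hfg.apply_apply_eq_zero m, ← h]
      exact (LinearMap.congr_fun hgt y).symm
    exact ⟨hf (by simpa [t, hy] using h), hy⟩
  have hrank : Module.finrank R N = Module.finrank R M + Module.finrank R P :=
    finrank_exact R (M₁ := FGModuleCat.of R M) (M₂ := FGModuleCat.of R N)
      (M₃ := FGModuleCat.of R P) hf hfg hg
  have ht : IsLattice t := by
    refine ⟨(injective_iff_map_eq_zero t).mpr fun y hy ↦ ?_, by simp [hrank]⟩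
    obtain ⟨h₁, h₂⟩ := ht_mem y 0 (hy.trans (map_zero f).symm)
    exact Prod.ext (hv.injective (h₁.trans (map_zero v).symm)) h₂
  have hcomap : (LinearMap.range t).comap f = LinearMap.range v := by
    ext m
    exact ⟨fun ⟨y, hy⟩ ↦ ⟨y.1, (ht_mem y m hy).1⟩, fun ⟨x, hx⟩ ↦ ⟨(x, 0), by simp [t, hx]⟩⟩
  have hmap : (LinearMap.range t).map g = LinearMap.range w := by
    rw [← LinearMap.range_comp, hgt, LinearMap.range_comp_of_range_eq_top w
      (LinearMap.range_eq_top.mpr LinearMap.snd_surjective)]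
  rw [← ht.mk_colengthDivisor, ← hv.mk_colengthDivisor, ← hw.mk_colengthDivisor,
    ← QuotientAddGroup.mk_add]
  congr 1
  ext p
  simp only [colengthDivisor, Pi.add_apply]
  rw [lengthAt_quotient_eq_add p.1 hfg hg, hcomap, hmap,
    ENat.toNat_add (hv.lengthAt_ne_top p) (hw.lengthAt_ne_top p), Nat.cast_add]

theorem divisorClass_eq_zero_of_isPseudoZero (h : IsPseudoZero R M) : divisorClass R M = 0 := by
  rw [divisorClass, ← QuotientAddGroup.mk_zero]
  congr 1
  ext p
  have hM : lengthAt p.1 M = 0 := isPseudoZero_iff_lengthAt_eq_zero.mp h p.1 p.2.2.le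
  have hN (L : Submodule R M) : lengthAt p.1 (M ⧸ L) = 0 := by
    rw [lengthAt_eq_add_of_exact p.1 L.subtype_injective (LinearMap.exact_subtype_mkQ L)
      L.mkQ_surjective] at hM
    exact (add_eq_zero.mp hM).2
  simp [colengthDivisor, hN]

variable (R) in
/-- The divisor class as a homomorphism on `G(R)`. -/
def divisorClassG : G R →+ DivisorClass R :=
  QuotientAddGroup.lift _ (FreeAbelianGroup.lift fun M : FGModuleCat.{u} R ↦ divisorClass R M) <| by
    rw [AddSubgroup.closure_le]
    rintro _ ⟨M₁, M₂, M₃, f, g, hf, hfg, hg, rfl⟩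
    have := divisorClass_eq_add_of_exact hf hfg hg
    simp only [SetLike.mem_coe, AddMonoidHom.mem_ker, map_sub, FreeAbelianGroup.lift_apply_of, this]
    abel

variable (R) in
/-- The divisor class as a homomorphism on `H(R)`. -/
def divisorClassH : H R →+ DivisorClass R :=
  QuotientAddGroup.lift _ (divisorClassG R) <| by
    rw [AddSubgroup.closure_le]
    rintro _ ⟨M, hM, rfl⟩
    have := divisorClass_eq_zero_of_isPseudoZero hM
    simp [G.cls, divisorClassG, this]

theorem divisorClassH_cls (M : FGModuleCat.{u} R) : divisorClassH R (H.cls M) = divisorClass R M :=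
  FreeAbelianGroup.lift_apply_of (fun M : FGModuleCat.{u} R ↦ divisorClass R M) M

end DivisorClass

/-! ### Maximal Cohen-Macaulay modules of rank one over a normal domain -/

section RankOne

variable {R : Type u} [CommRing R] [IsDomain R]
variable {M N : Type u} [AddCommGroup M] [Module R M] [AddCommGroup N] [Module R N]

theorem exists_isLattice_of_finrank_eq_one (h : Module.finrank R M = 1) :
    ∃ v : R →ₗ[R] M, IsLattice v := by
  obtain ⟨v, hv⟩ := exists_isLattice R M
  let e : R ≃ₗ[R] (Fin (Module.finrank R M) → R) := LinearEquiv.ofFinrankEq _ _ (by simp [h])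
  exact ⟨v ∘ₗ e.toLinearMap, hv.comp ⟨e.injective, e.finrank_eq⟩⟩

theorem lengthAt_quotient_range_smul_id [IsNoetherianRing R] [IsIntegrallyClosed R] {a : R}
    (ha : a ≠ 0) (p : HeightOne R) :
    lengthAt p.1 (R ⧸ LinearMap.range (a • LinearMap.id : R →ₗ[R] R)) =
      Ring.ord (Localization.AtPrime p.1) (algebraMap R _ a) := by
  have := isDiscreteValuationRing_atPrime p.1 p.2.2
  rw [lengthAt_quotient_range_eq_ord_det p.1 (smul_right_injective R ha)]
  simp

theorem exists_isLattice_lengthAt_eq [IsNoetherianRing R] [IsIntegrallyClosed R]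
    [Module.Finite R M] [Module.Finite R N] (hM : Module.finrank R M = 1)
    (hN : Module.finrank R N = 1) (h : divisorClass R M = divisorClass R N) :
    ∃ (v : R →ₗ[R] M) (w : R →ₗ[R] N), IsLattice v ∧ IsLattice w ∧ ∀ p : HeightOne R,
      lengthAt p.1 (M ⧸ LinearMap.range v) = lengthAt p.1 (N ⧸ LinearMap.range w) := by
  obtain ⟨v, hv⟩ := exists_isLattice_of_finrank_eq_one hM
  obtain ⟨w, hw⟩ := exists_isLattice_of_finrank_eq_one hN
  rw [← hv.mk_colengthDivisor, ← hw.mk_colengthDivisor, QuotientAddGroup.eq] at h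
  obtain ⟨a, b, ha, hb, h⟩ := h
  refine ⟨v ∘ₗ (a • LinearMap.id), w ∘ₗ (b • LinearMap.id), hv.comp (isLattice_smul_id ha),
    hw.comp (isLattice_smul_id hb), fun p ↦ ?_⟩
  have hp := congr_fun h p
  simp only [colengthDivisor, divisorOf, Pi.add_apply, Pi.neg_apply, Pi.sub_apply] at hp
  rw [lengthAt_quotient_range_comp _ _ hv.injective, lengthAt_quotient_range_comp _ _ hw.injective,
    lengthAt_quotient_range_smul_id ha, lengthAt_quotient_range_smul_id hb]
  lift Ring.ord (Localization.AtPrime p.1) (algebraMap R _ a) to ℕ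
    using ord_algebraMap_ne_top ha p with i
  lift Ring.ord (Localization.AtPrime p.1) (algebraMap R _ b) to ℕ
    using ord_algebraMap_ne_top hb p with j
  lift lengthAt p.1 (M ⧸ LinearMap.range v) to ℕ using hv.lengthAt_ne_top p with k
  lift lengthAt p.1 (N ⧸ LinearMap.range w) to ℕ using hw.lengthAt_ne_top p with l
  simp only [ENat.toNat_natCast] at hp
  norm_cast
  omega

theorem IsLattice.exists_injective_fractionRing [Module.Finite R M] [Module.IsTorsionFree R M]
    {v : R →ₗ[R] M} (hv : IsLattice v) : ∃ f : M →ₗ[R] FractionRing R, Function.Injective f ∧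
      ∀ x, f (v x) = algebraMap R (FractionRing R) x := by
  obtain ⟨c, hc, h⟩ := hv.exists_smul_mem
  obtain ⟨g, hg⟩ := exists_comp_eq_of_forall_mem_range hv.injective (c • LinearMap.id) h
  have hvg (m) : v (g m) = c • m := LinearMap.congr_fun hg m
  have hgv (x) : g (v x) = c * x := hv.injective (by rw [hvg, ← smul_eq_mul, map_smul])
  have hginj : Function.Injective g := .of_comp (f := v) <| by
    rw [← LinearMap.coe_comp, hg]
    exact smul_right_injective M hc
  have hc' : algebraMap R (FractionRing R) c ≠ 0 := by simpa using hc
  refine ⟨(algebraMap R (FractionRing R) c)⁻¹ • (Algebra.linearMap R (FractionRing R) ∘ₗ g), ?_,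
    fun x ↦ by simp [hgv, hc']⟩
  exact (smul_right_injective (FractionRing R) (inv_ne_zero hc')).comp
    ((IsFractionRing.injective R (FractionRing R)).comp hginj)

theorem exists_notMem_smul_eq_smul_of_dvd [Module.IsTorsionFree R M] {p : Ideal R} [p.IsPrime]
    {a b : R} (hb : b ≠ 0) {x y : M} (hxy : b • x = a • y)
    (h : algebraMap R (Localization.AtPrime p) b ∣ algebraMap R _ a) :
    ∃ t ∉ p, ∃ c : R, t • x = c • y := by
  obtain ⟨z, hz⟩ := h
  obtain ⟨c, t, rfl⟩ := IsLocalization.exists_mk'_eq p.primeCompl z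
  rw [IsLocalization.mul_mk'_eq_mk'_of_mul, eq_comm, IsLocalization.mk'_eq_iff_eq_mul,
    ← map_mul] at hz
  have hbc : b * c = a * t :=
    IsLocalization.injective (Localization.AtPrime p) p.primeCompl_le_nonZeroDivisors hz
  refine ⟨t, t.2, c, smul_right_injective M hb ?_⟩
  change b • (t : R) • x = b • c • y
  rw [smul_comm, hxy, smul_smul, smul_smul, hbc, mul_comm]

section Fractions

variable {K : Type u} [Field K] [Algebra R K] [IsFractionRing R K]

theorem exists_notMem_smul_eq_smul_or (p : Ideal R) [p.IsPrime]
    [ValuationRing (Localization.AtPrime p)] (x y : K) :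
    (∃ t ∉ p, ∃ c : R, t • x = c • y) ∨ ∃ t ∉ p, ∃ c : R, t • y = c • x := by
  rcases eq_or_ne x 0 with rfl | hx
  · exact .inl ⟨1, Ideal.one_notMem p, 0, by simp⟩
  rcases eq_or_ne y 0 with rfl | hy
  · exact .inr ⟨1, Ideal.one_notMem p, 0, by simp⟩
  obtain ⟨a, b, hb, hab⟩ := IsFractionRing.div_surjective (A := R) (x / y)
  have hb0 : b ≠ 0 := nonZeroDivisors.ne_zero hb
  have hbK : algebraMap R K b ≠ 0 := by simpa using hb0
  have hxy : b • x = a • y := by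
    rw [Algebra.smul_def, Algebra.smul_def, mul_comm, (div_eq_div_iff hbK hy).mp hab]
  have ha0 : a ≠ 0 := by
    rintro rfl
    simp [hb0, hx] at hxy
  have : Module.IsTorsionFree R K := inferInstance
  rcases ValuationRing.dvd_total (algebraMap R (Localization.AtPrime p) b) (algebraMap R _ a)
    with h | h
  · exact .inl (exists_notMem_smul_eq_smul_of_dvd hb0 hxy h)
  · exact .inr (exists_notMem_smul_eq_smul_of_dvd ha0 hxy.symm h)

theorem forall_exists_smul_mem_or (p : Ideal R) [p.IsPrime]
    [ValuationRing (Localization.AtPrime p)] (I J : Submodule R K) :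
    (∀ x ∈ I, ∃ t ∉ p, t • x ∈ J) ∨ ∀ y ∈ J, ∃ t ∉ p, t • y ∈ I := by
  by_contra! hcon
  obtain ⟨⟨x, hx, hxJ⟩, y, hy, hyI⟩ := hcon
  rcases exists_notMem_smul_eq_smul_or p x y with ⟨t, ht, c, htx⟩ | ⟨t, ht, c, hty⟩
  · exact hxJ t ht (htx ▸ J.smul_mem c hy)
  · exact hyI t ht (hty ▸ I.smul_mem c hx)

/- The two fractional ideals are comparable at `p`. If the image of `N` is the smaller one, then it
has colength zero in their sum, and so has the image of `M`, as both have the same colength. -/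
theorem exists_smul_mem_range_of_lengthAt_eq [IsNoetherianRing R] [IsIntegrallyClosed R]
    [Module.Finite R M] {v : R →ₗ[R] M} {w : R →ₗ[R] N} (hv : IsLattice v)
    {f : M →ₗ[R] K} {g : N →ₗ[R] K} (hf : Function.Injective f) (hg : Function.Injective g)
    (hfg : ∀ x, f (v x) = g (w x)) {p : HeightOne R}
    (h : lengthAt p.1 (M ⧸ LinearMap.range v) = lengthAt p.1 (N ⧸ LinearMap.range w)) (m : M) :
    ∃ t ∉ p.1, t • f m ∈ LinearMap.range g := by
  have := isDiscreteValuationRing_atPrime p.1 p.2.2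
  rcases forall_exists_smul_mem_or p.1 (LinearMap.range f) (LinearMap.range g) with hcase | hcase
  · exact hcase _ ⟨m, rfl⟩
  let L : Submodule R K := LinearMap.range f ⊔ LinearMap.range g
  let f' : M →ₗ[R] L := f.codRestrict L fun m ↦ (le_sup_left : _ ≤ L) ⟨m, rfl⟩
  let g' : N →ₗ[R] L := g.codRestrict L fun m ↦ (le_sup_right : _ ≤ L) ⟨m, rfl⟩
  have hf' : Function.Injective f' := fun a b hab ↦ hf (congr_arg Subtype.val hab)
  have hg' : Function.Injective g' := fun a b hab ↦ hg (congr_arg Subtype.val hab)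
  have hcomp : f' ∘ₗ v = g' ∘ₗ w := LinearMap.ext fun x ↦ Subtype.ext (hfg x)
  have hlen : lengthAt p.1 (L ⧸ LinearMap.range f') = lengthAt p.1 (L ⧸ LinearMap.range g') := by
    refine ENat.add_right_injective_of_ne_top (hv.lengthAt_ne_top p) ?_
    dsimp only
    rw [← lengthAt_quotient_range_comp p.1 v hf', hcomp, lengthAt_quotient_range_comp p.1 w hg', h]
  have hzero : lengthAt p.1 (L ⧸ LinearMap.range f') = 0 := by
    rw [lengthAt_eq_zero_iff]
    intro x
    obtain ⟨⟨x, hx⟩, rfl⟩ := Submodule.Quotient.mk_surjective _ x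
    obtain ⟨_, ⟨a, rfl⟩, y, hy, rfl⟩ := Submodule.mem_sup.mp hx
    obtain ⟨t, ht, b, hb⟩ := hcase y hy
    refine ⟨t, ht, ?_⟩
    rw [← Submodule.Quotient.mk_smul, Submodule.Quotient.mk_eq_zero]
    refine ⟨t • a + b, Subtype.ext ?_⟩
    change f (t • a + b) = t • (f a + y)
    rw [map_add, map_smul, hb, smul_add]
  obtain ⟨t, ht, htm⟩ := (lengthAt_eq_zero_iff _).mp (hlen ▸ hzero) (Submodule.Quotient.mk (f' m))
  rw [← Submodule.Quotient.mk_smul, Submodule.Quotient.mk_eq_zero] at htm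
  obtain ⟨b, hb⟩ := htm
  exact ⟨t, ht, b, congr_arg Subtype.val hb⟩

theorem range_le_range_of_lengthAt_eq [IsNoetherianRing R] [IsIntegrallyClosed R]
    [Module.Finite R M] (hN : IsMCM R N) {v : R →ₗ[R] M} {w : R →ₗ[R] N} (hv : IsLattice v)
    {f : M →ₗ[R] K} {g : N →ₗ[R] K} (hf : Function.Injective f) (hg : Function.Injective g)
    (hfg : ∀ x, f (v x) = g (w x)) (h : ∀ p : HeightOne R,
      lengthAt p.1 (M ⧸ LinearMap.range v) = lengthAt p.1 (N ⧸ LinearMap.range w)) :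
    LinearMap.range f ≤ LinearMap.range g := by
  rintro _ ⟨m, rfl⟩
  have : Module.IsTorsionFree R K := inferInstance
  refine mem_range_of_isMCM hN hg fun p hp hp1 ↦ ?_
  rcases hp1.eq_or_lt with hp1 | hp1
  · exact exists_smul_mem_range_of_lengthAt_eq (p := ⟨p, hp, hp1⟩) hv hf hg hfg (h _) m
  · obtain rfl : p = ⊥ := by rwa [← Ideal.height_eq_zero_iff_eq_bot, ← Order.lt_one_iff]
    obtain ⟨c, hc, hcv⟩ := hv.exists_smul_mem
    obtain ⟨x, hx⟩ := hcv m
    exact ⟨c, by simpa using hc, w x, by rw [← hfg, hx, map_smul]⟩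

end Fractions

theorem nonempty_linearEquiv_of_H_cls_eq [IsNoetherianRing R] [IsIntegrallyClosed R]
    {M N : FGModuleCat.{u} R} (hM : IsMCM R M) (hN : IsMCM R N) (hM1 : Module.finrank R M = 1)
    (hN1 : Module.finrank R N = 1) (h : H.cls M = H.cls N) : Nonempty (M ≃ₗ[R] N) := by
  have hdiv : divisorClass R M = divisorClass R N := by
    rw [← divisorClassH_cls, ← divisorClassH_cls, h]
  obtain ⟨v, w, hv, hw, hlen⟩ := exists_isLattice_lengthAt_eq hM1 hN1 hdiv
  have := hM.isTorsionFree
  have := hN.isTorsionFree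
  obtain ⟨f, hf, hfv⟩ := hv.exists_injective_fractionRing
  obtain ⟨g, hg, hgw⟩ := hw.exists_injective_fractionRing
  have hfg (x) : f (v x) = g (w x) := (hfv x).trans (hgw x).symm
  have hrange : LinearMap.range f = LinearMap.range g := le_antisymm
    (range_le_range_of_lengthAt_eq hN hv hf hg hfg hlen)
    (range_le_range_of_lengthAt_eq hM hw hg hf (fun x ↦ (hfg x).symm) fun p ↦ (hlen p).symm)
  exact ⟨(LinearEquiv.ofInjective f hf).trans ((LinearEquiv.ofEq _ _ hrange).trans
    (LinearEquiv.ofInjective g hg).symm)⟩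

end RankOne

/-! ### The class of the canonical dual -/

section Dual

section DiscreteValuationRing

theorem length_quotient_range_congr {B : Type*} [CommRing B] {F F' M M' : Type*}
    [AddCommGroup F] [Module B F] [AddCommGroup F'] [Module B F'] [AddCommGroup M] [Module B M]
    [AddCommGroup M'] [Module B M'] {f : F →ₗ[B] M} {f' : F' →ₗ[B] M'} (e₁ : F ≃ₗ[B] F')
    (e₂ : M ≃ₗ[B] M') (h : e₂.toLinearMap ∘ₗ f = f' ∘ₗ e₁.toLinearMap) :
    Module.length B (M ⧸ LinearMap.range f) = Module.length B (M' ⧸ LinearMap.range f') := by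
  refine (Submodule.Quotient.equiv _ _ e₂ ?_).length_eq
  rw [← LinearMap.range_comp, h, LinearMap.range_comp_of_range_eq_top f' e₁.range]

variable {B : Type*} [CommRing B] [IsDomain B] {F M N : Type*}
  [AddCommGroup F] [Module B F] [Module.Free B F] [Module.Finite B F]
  [AddCommGroup M] [Module B M] [Module.Free B M] [Module.Finite B M]
  [AddCommGroup N] [Module B N] [Module.Free B N]

theorem dualMap_injective {A : F →ₗ[B] F} (hA : Function.Injective A) :
    Function.Injective A.dualMap := by
  rw [← LinearMap.ker_eq_bot]
  by_contra h
  rw [← ne_eq, ← LinearMap.det_eq_zero_iff_ker_ne_bot, LinearMap.det_dualMap] at h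
  exact det_ne_zero_of_injective hA h

theorem length_quotient_range_lcomp [IsDiscreteValuationRing B] (hN : Module.finrank B N = 1)
    {v : F →ₗ[B] M} (hv : Function.Injective v)
    (hrank : Module.finrank B F = Module.finrank B M) :
    Module.length B ((F →ₗ[B] N) ⧸ LinearMap.range (LinearMap.lcomp B N v)) =
      Module.length B (M ⧸ LinearMap.range v) := by
  let e : F ≃ₗ[B] M := LinearEquiv.ofFinrankEq F M hrank
  have : Module.Finite B N := Module.finite_of_finrank_eq_succ hN
  let c : N ≃ₗ[B] B := LinearEquiv.ofFinrankEq N B (by simp [hN])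
  let A : F →ₗ[B] F := e.symm.toLinearMap ∘ₗ v
  have hA : Function.Injective A := e.symm.injective.comp hv
  calc
    _ = Module.length B (Module.Dual B F ⧸ LinearMap.range A.dualMap) := by
      refine length_quotient_range_congr (LinearEquiv.arrowCongr e.symm c)
        (LinearEquiv.arrowCongr (LinearEquiv.refl B F) c) ?_
      ext
      simp [A]
    _ = Module.length B (F ⧸ LinearMap.range A) := by
      rw [length_quotient_range_eq_ord_det hA,
        length_quotient_range_eq_ord_det (dualMap_injective hA), LinearMap.det_dualMap]
    _ = _ := (length_quotient_range_congr (LinearEquiv.refl B F) e.symm rfl).symm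

end DiscreteValuationRing

variable {R : Type u} [CommRing R] [IsDomain R] [IsNoetherianRing R]
variable {M N F : Type u} [AddCommGroup M] [Module R M] [AddCommGroup N] [Module R N]
  [AddCommGroup F] [Module R F] [Module.Finite R F] [Module.Finite R M] [Module.Finite R N]
  [Module.IsTorsionFree R N]

theorem IsLattice.lcomp {v : F →ₗ[R] M} (hv : IsLattice v) :
    IsLattice (LinearMap.lcomp R N v) := by
  refine ⟨fun f g hfg ↦ LinearMap.ext fun m ↦ ?_, ?_⟩
  · obtain ⟨c, hc, h⟩ := hv.exists_smul_mem
    obtain ⟨x, hx⟩ := h m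
    apply smul_right_injective N hc
    change c • f m = c • g m
    rw [← map_smul, ← map_smul, ← hx]
    exact LinearMap.congr_fun hfg x
  · rw [finrank_linearMap_of_isDomain, finrank_linearMap_of_isDomain, hv.finrank_eq]

theorem lengthAt_quotient_range_lcomp [IsIntegrallyClosed R] [Module.IsTorsionFree R M]
    [Module.Free R F] (hN : Module.finrank R N = 1) {v : F →ₗ[R] M} (hv : IsLattice v)
    (p : HeightOne R) :
    lengthAt p.1 ((F →ₗ[R] N) ⧸ LinearMap.range (LinearMap.lcomp R N v)) =
      lengthAt p.1 (M ⧸ LinearMap.range v) := by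
  have := isDiscreteValuationRing_atPrime p.1 p.2.2
  let S := p.1.primeCompl
  have hS : S ≤ nonZeroDivisors R := p.1.primeCompl_le_nonZeroDivisors
  have hfree (X : Type u) [AddCommGroup X] [Module R X] [Module.Finite R X]
      [Module.IsTorsionFree R X] : Module.Free (Localization S) (LocalizedModule S X) := by
    have : Module.IsTorsionFree (Localization S) (LocalizedModule S X) := inferInstance
    have : Module.Finite (Localization S) (LocalizedModule S X) := inferInstance
    infer_instance
  have := hfree M
  have := hfree N
  have := Module.finitePresentation_of_finite R M
  have := Module.finitePresentation_of_finite R F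
  let v' := LocalizedModule.map S v
  have hcomp (f : M →ₗ[R] N) : LinearMap.lcomp (Localization S) (LocalizedModule S N) v'
      (LocalizedModule.map S f) = LocalizedModule.map S (LinearMap.lcomp R N v f) := by
    refine LinearMap.ext fun w ↦ ?_
    induction w using LocalizedModule.induction_on with
    | h x t => simp [v', S]
  rw [lengthAt_quotient_range p.1 (LocalizedModule.map S) (LocalizedModule.map S)
      (f' := LinearMap.lcomp _ _ v') hcomp,
    lengthAt_quotient_range p.1 (LocalizedModule.mkLinearMap S F)
      (LocalizedModule.mkLinearMap S M) (f' := v') (fun x ↦ by simp [v'])]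
  exact length_quotient_range_lcomp (by rw [finrank_localizedModule hS, hN])
    (LocalizedModule.map_injective S v hv.injective)
    (by rw [finrank_localizedModule hS, finrank_localizedModule hS, hv.finrank_eq])

variable (M N) in
theorem H.cls_linearMap_add_cls [IsIntegrallyClosed R] [Module.IsTorsionFree R M]
    (hN : Module.finrank R N = 1) :
    H.cls (FGModuleCat.of R (M →ₗ[R] N)) + H.cls (FGModuleCat.of R M) =
      Module.finrank R M • (H.cls (FGModuleCat.of R R) + H.cls (FGModuleCat.of R N)) := by
  obtain ⟨v, hv⟩ := exists_isLattice R M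
  have hv' := hv.lcomp (N := N)
  have hM := H.cls_eq_add_of_exact (M₁ := FGModuleCat.of R (Fin (Module.finrank R M) → R))
    (M₂ := FGModuleCat.of R M) (M₃ := FGModuleCat.of R (M ⧸ LinearMap.range v)) v
    (LinearMap.range v).mkQ hv.injective (LinearMap.exact_map_mkQ_range v)
    (Submodule.mkQ_surjective _)
  have hHom := H.cls_eq_add_of_exact (M₁ := FGModuleCat.of R (M →ₗ[R] N))
    (M₂ := FGModuleCat.of R ((Fin (Module.finrank R M) → R) →ₗ[R] N))
    (M₃ := FGModuleCat.of R (_ ⧸ LinearMap.range (LinearMap.lcomp R N v)))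
    (LinearMap.lcomp R N v) (LinearMap.range (LinearMap.lcomp R N v)).mkQ hv'.injective
    (LinearMap.exact_map_mkQ_range _) (Submodule.mkQ_surjective _)
  have hcoker := H.cls_eq_of_lengthAt_eq hv'.finrank_quotient_range hv.finrank_quotient_range
    (lengthAt_quotient_range_lcomp hN hv)
  have hfree := H.cls_congr (M := FGModuleCat.of R ((Fin (Module.finrank R M) → R) →ₗ[R] N))
    (N := FGModuleCat.of R (Fin (Module.finrank R M) → N))
    ((Pi.basisFun R (Fin (Module.finrank R M))).constr R).symm
  rw [H.cls_pi] at hM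
  rw [hfree, hcoker, H.cls_pi] at hHom
  rw [hM, nsmul_add, hHom]
  abel

end Dual

/-! ### Cones in a half-space -/

section Cone

variable {V : Type*} [AddCommGroup V] [Module ℝ V] {ρ : V →ₗ[ℝ] ℝ} {s : Set V}

theorem eq_zero_or_mem_convexConeHull {x : V} (hx : x ∈ PointedCone.hull ℝ s) :
    x = 0 ∨ x ∈ ConvexCone.hull ℝ s := by
  induction hx using Submodule.span_induction with
  | mem x hx => exact Or.inr (ConvexCone.subset_hull hx)
  | zero => exact Or.inl rfl
  | add x y _ _ hx hy =>
    rcases hx with rfl | hx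
    · simpa only [zero_add] using hy
    rcases hy with rfl | hy
    · simpa only [add_zero] using Or.inr hx
    · exact Or.inr (add_mem hx hy)
  | smul a x _ hx =>
    rcases eq_zero_or_pos a with rfl | ha
    · exact Or.inl (zero_smul _ x)
    rcases hx with rfl | hx
    · exact Or.inl (smul_zero a)
    · exact Or.inr ((ConvexCone.hull ℝ s).smul_mem ha hx)

theorem pos_of_mem_hull (hs : ∀ x ∈ s, 0 < ρ x) {x : V} (hx : x ∈ PointedCone.hull ℝ s)
    (hx0 : x ≠ 0) : 0 < ρ x := by
  have h : ConvexCone.hull ℝ s ≤ (ConvexCone.strictlyPositive ℝ ℝ).comap ρ :=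
    ConvexCone.hull_min hs
  exact h ((eq_zero_or_mem_convexConeHull hx).resolve_left hx0)

theorem hull_convexHull : PointedCone.hull ℝ (convexHull ℝ s) = PointedCone.hull ℝ s :=
  le_antisymm
    (Submodule.span_le.mpr (convexHull_min PointedCone.subset_hull (PointedCone.hull ℝ s).convex))
    (Submodule.span_mono (subset_convexHull ℝ s))

theorem mem_hull_iff_of_convex (hs : Convex ℝ s) (hρ : ∀ x ∈ s, 0 < ρ x) {x : V} :
    x ∈ PointedCone.hull ℝ s ↔ x = 0 ∨ 0 ≤ ρ x ∧ ∃ y ∈ s, ρ y • x = ρ x • y := by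
  constructor
  · refine fun hx ↦ (eq_zero_or_mem_convexConeHull hx).imp_right fun hx ↦ ?_
    obtain ⟨c, hc, y, hy, rfl⟩ := (ConvexCone.mem_hull_of_convex hs).mp hx
    have := hρ y hy
    refine ⟨?_, y, hy, ?_⟩ <;> rw [map_smul, smul_eq_mul]
    · positivity
    · rw [smul_smul, mul_comm]
  · rintro (rfl | ⟨hx, y, hy, h⟩)
    · exact zero_mem _
    · rw [← inv_smul_smul₀ (hρ y hy).ne' x, h]
      exact PointedCone.smul_mem _ (inv_nonneg.mpr (hρ y hy).le)
        (PointedCone.smul_mem _ hx (PointedCone.subset_hull hy))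

end Cone

section NormedCone

variable {V : Type*} [NormedAddCommGroup V] [NormedSpace ℝ V] {ρ : V →ₗ[ℝ] ℝ} {s : Set V}
  {C : PointedCone ℝ V}

theorem isClosed_hull_of_isCompact (hρ : Continuous ρ) (hs : Convex ℝ s) (hs' : IsCompact s)
    (hpos : ∀ x ∈ s, 0 < ρ x) : IsClosed (PointedCone.hull ℝ s : Set V) := by
  have : CompactSpace s := isCompact_iff_compactSpace.mp hs'
  let Z : Set (V × s) := {z | 0 ≤ ρ z.1 ∧ ρ z.2 • z.1 = ρ z.1 • (z.2 : V)}
  have h₁ : IsClosed {z : V × s | 0 ≤ ρ z.1} := isClosed_le (by fun_prop) (by fun_prop)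
  have h₂ : IsClosed {z : V × s | ρ z.2 • z.1 = ρ z.1 • (z.2 : V)} :=
    isClosed_eq (by fun_prop) (by fun_prop)
  have h : (PointedCone.hull ℝ s : Set V) = {0} ∪ Prod.fst '' Z := by
    ext x
    rw [SetLike.mem_coe, mem_hull_iff_of_convex hs hpos]
    simp [Z]
  rw [h]
  exact isClosed_singleton.union (isClosedMap_fst_of_compactSpace _ (h₁.inter h₂))

theorem isClosed_hull_of_finite (hρ : Continuous ρ) (hs : s.Finite) (hpos : ∀ x ∈ s, 0 < ρ x) :
    IsClosed (PointedCone.hull ℝ s : Set V) := by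
  rw [← hull_convexHull]
  exact isClosed_hull_of_isCompact hρ (convex_convexHull ℝ s) (hs.isCompact_convexHull ℝ)
    (convexHull_min hpos (convex_halfSpace_gt ρ.isLinear 0))

theorem nonneg_of_mem_closure (hρ : Continuous ρ) (hC : ∀ x ∈ C, 0 ≤ ρ x) {x : V}
    (hx : x ∈ closure (C : Set V)) : 0 ≤ ρ x :=
  closure_minimal hC (isClosed_le continuous_const hρ) hx

theorem neg_mem_closure_of_forall_smul_sub_mem (hρ : Continuous ρ) {w x : V}
    (hw : ∀ y ∈ C, ρ y • w - y ∈ C) (hx : x ∈ closure (C : Set V)) (hx0 : ρ x = 0) :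
    -x ∈ closure (C : Set V) := by
  have := map_mem_closure (f := fun y ↦ ρ y • w - y) (by fun_prop) hx hw
  simpa only [hx0, zero_smul, zero_sub] using this

theorem exists_norm_le_mul [ProperSpace V] (hρ : Continuous ρ) (hC : ∀ x ∈ C, 0 ≤ ρ x)
    (h : ∀ x ∈ closure (C : Set V), ρ x = 0 → x = 0) : ∃ B, ∀ x ∈ C, ‖x‖ ≤ B * ρ x := by
  let T := Metric.sphere (0 : V) 1 ∩ closure (C : Set V)
  have hT : IsCompact T := (isCompact_sphere _ _).inter_right isClosed_closure
  have hpos : ∀ y ∈ T, 0 < ρ y := fun y hy ↦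
    (nonneg_of_mem_closure hρ hC hy.2).lt_of_ne' fun h0 ↦
      Metric.ne_of_mem_sphere hy.1 one_ne_zero (h y hy.2 h0)
  obtain ⟨m, hm, hmT⟩ := hT.exists_forall_le' hρ.continuousOn hpos
  refine ⟨m⁻¹, fun x hx ↦ ?_⟩
  rcases eq_or_ne x 0 with rfl | hx0
  · simp
  have hxT : ‖x‖⁻¹ • x ∈ T :=
    ⟨by simp [norm_smul, hx0], subset_closure (PointedCone.smul_mem _ (by positivity) hx)⟩
  have hle : m ≤ ‖x‖⁻¹ * ρ x := by simpa using hmT _ hxT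
  rwa [le_inv_mul_iff₀ (norm_pos_iff.mpr hx0), mul_comm, ← le_inv_mul_iff₀ hm] at hle

theorem exists_norm_le_mul_of_isBounded (hC : ∀ x ∈ C, x ≠ 0 → 0 < ρ x) {c : ℝ} (hc : 0 < c)
    (h : Bornology.IsBounded {x | x ∈ C ∧ ρ x = c}) : ∃ B, ∀ x ∈ C, ‖x‖ ≤ B * ρ x := by
  obtain ⟨B, hB⟩ := isBounded_iff_forall_norm_le.mp h
  refine ⟨B / c, fun x hx ↦ ?_⟩
  rcases eq_or_ne x 0 with rfl | hx0
  · simp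
  have hρx := hC x hx hx0
  have hle := hB ((c / ρ x) • x)
    ⟨PointedCone.smul_mem _ (by positivity) hx, by simp [hρx.ne']⟩
  rw [norm_smul, Real.norm_of_nonneg (by positivity)] at hle
  calc ‖x‖ = c / ρ x * ‖x‖ * (ρ x / c) := by field_simp
    _ ≤ B * (ρ x / c) := by gcongr
    _ = B / c * ρ x := by ring

theorem isBounded_setOf_eq_iff [ProperSpace V] (hρ : Continuous ρ)
    (hC : ∀ x ∈ C, x ≠ 0 → 0 < ρ x) {c : ℝ} (hc : 0 < c) :
    Bornology.IsBounded {x | x ∈ C ∧ ρ x = c} ↔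
      ∀ x ∈ closure (C : Set V), ρ x = 0 → x = 0 := by
  constructor
  · intro h x hx hx0
    obtain ⟨B, hB⟩ := exists_norm_le_mul_of_isBounded hC hc h
    have hle : ‖x‖ ≤ B * ρ x :=
      closure_minimal hB (isClosed_le continuous_norm (continuous_const.mul hρ)) hx
    simpa [hx0] using hle
  · intro h
    have hC' : ∀ x ∈ C, 0 ≤ ρ x := fun x hx ↦ by
      rcases eq_or_ne x 0 with rfl | hx0
      · simp
      · exact (hC x hx hx0).le
    obtain ⟨B, hB⟩ := exists_norm_le_mul hρ hC' h
    exact isBounded_iff_forall_norm_le.mpr ⟨B * c, fun x hx ↦ hx.2 ▸ hB x hx.1⟩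

end NormedCone

/-! ### Integral points -/

section IntegralPoints

theorem finite_setOf_intCast_mem {B : Set ℝ} (hB : Bornology.IsBounded B) :
    {k : ℤ | (k : ℝ) ∈ B}.Finite := by
  have hB' : Bᶜ ∈ Filter.cocompact ℝ := by
    rwa [← Metric.cobounded_eq_cocompact, ← Bornology.isBounded_def]
  have h := Int.tendsto_coe_cofinite hB'
  rwa [Filter.mem_map, Filter.mem_cofinite, Set.preimage_compl, compl_compl] at h

theorem exists_finite_preimage_singleton (A : Type*) [AddCommGroup A] [Module.Finite ℤ A] :
    ∃ (n : ℕ) (c : A →ₗ[ℤ] Fin n → ℤ), ∀ v, (c ⁻¹' {v}).Finite := by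
  let π := (Submodule.torsion ℤ A).mkQ
  let e := (Module.finBasis ℤ (A ⧸ Submodule.torsion ℤ A)).equivFun
  refine ⟨_, e.toLinearMap ∘ₗ π, fun v ↦ ?_⟩
  have : Finite (Submodule.torsion ℤ A) :=
    Module.finite_of_fg_torsion _ (Submodule.torsion_isTorsion)
  obtain ⟨a, rfl⟩ : ∃ a, e (π a) = v :=
    (e.surjective.comp (Submodule.mkQ_surjective _)) v
  refine ((Set.toFinite (Submodule.torsion ℤ A : Set A)).image (a + ·)).subset fun a' ha' ↦ ?_
  have h : π a = π a' := e.injective (Set.mem_singleton_iff.mp ha').symm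
  exact ⟨-a + a', (Submodule.Quotient.eq' _).mp h, by simp⟩

theorem finite_setOf_one_tmul_mem {A : Type*} [AddCommGroup A] [Module.Finite ℤ A]
    {B : Set (ℝ ⊗[ℤ] A)} (hB : ∀ l : Module.Dual ℝ (ℝ ⊗[ℤ] A), Bornology.IsBounded (l '' B)) :
    {a : A | (1 : ℝ) ⊗ₜ[ℤ] a ∈ B}.Finite := by
  obtain ⟨n, c, hc⟩ := exists_finite_preimage_singleton A
  let l (i : Fin n) : Module.Dual ℝ (ℝ ⊗[ℤ] A) :=
    (TensorProduct.AlgebraTensorModule.rid ℤ ℝ ℝ).toLinearMap ∘ₗ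
      (LinearMap.proj i ∘ₗ c).baseChange ℝ
  have hl (i : Fin n) (a : A) : l i (1 ⊗ₜ a) = c a i := by simp [l]
  have hfin : (Set.univ.pi fun i ↦ {k : ℤ | (k : ℝ) ∈ l i '' B}).Finite :=
    Set.Finite.pi fun i ↦ finite_setOf_intCast_mem (hB (l i))
  exact (hfin.preimage' fun v _ ↦ hc v).subset fun a ha i _ ↦ ⟨_, ha, hl i a⟩

end IntegralPoints

/-! ### The conditions on maximal Cohen-Macaulay modules of a fixed rank -/

section Conditions

variable {R : Type u} [CommRing R] {r n : ℕ} (b : Module.Basis (Fin n) ℝ (HR R))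

/-- The norm on `H(R)_ℝ` for which the basis `b` is orthonormal. Its metric is definitionally
`euclideanMetric b`, so that facts on normed spaces apply to the conditions. -/
abbrev euclideanNorm : NormedAddCommGroup (HR R) :=
  NormedAddCommGroup.induced (HR R) (EuclideanSpace ℝ (Fin n))
    (b.equivFun ≪≫ₗ (WithLp.linearEquiv 2 ℝ (Fin n → ℝ)).symm)
    ((WithLp.toLp_injective 2).comp b.equivFun.injective)

/-- The normed space structure belonging to `euclideanNorm b`. -/
abbrev euclideanNormedSpace : letI := euclideanNorm b; NormedSpace ℝ (HR R) :=
  letI := euclideanNorm b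
  NormedSpace.induced ℝ (HR R) (EuclideanSpace ℝ (Fin n))
    (b.equivFun ≪≫ₗ (WithLp.linearEquiv 2 ℝ (Fin n → ℝ)).symm)

theorem mcmPoints_subset_mcmCone : mcmPoints R r ⊆ mcmCone R r := PointedCone.subset_hull

theorem mcmCone_subset_coneClosure : (mcmCone R r : Set (HR R)) ⊆ coneClosure r b :=
  letI := euclideanMetric b
  subset_closure

theorem finitelyManyPoints_iff : FinitelyManyPoints R r ↔ (mcmPoints R r).Finite := by
  rw [FinitelyManyPoints, Set.inter_eq_left.mpr mcmPoints_subset_mcmCone]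

theorem FinitelyManyMCM.finitelyManyPoints (h : FinitelyManyMCM R r) : FinitelyManyPoints R r := by
  obtain ⟨S, hS, h⟩ := h
  refine finitelyManyPoints_iff.mpr ((hS.image HR.cls).subset ?_)
  rintro _ ⟨M, hM, hMr, rfl⟩
  obtain ⟨N, hN, ⟨e⟩⟩ := h M hM hMr
  exact ⟨N, hN, by rw [HR.cls, HR.cls, H.cls_congr e]⟩

theorem FinitelyManyPoints.conePolyhedral (h : FinitelyManyPoints R r) : ConePolyhedral R r :=
  have h := finitelyManyPoints_iff.mp h
  ⟨h.toFinset, by rw [h.coe_toFinset, mcmCone]⟩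

theorem closureStronglyConvex_iff : ClosureStronglyConvex r b ↔
    ∀ x ∈ coneClosure r b, -x ∈ coneClosure r b → x = 0 := by
  have h0 : (0 : HR R) ∈ coneClosure r b := mcmCone_subset_coneClosure b (zero_mem _)
  rw [ClosureStronglyConvex, Set.eq_singleton_iff_unique_mem]
  exact ⟨fun h x hx hx' ↦ h.2 x ⟨hx, hx'⟩,
    fun h ↦ ⟨⟨h0, by rwa [neg_zero]⟩, fun x hx ↦ h x hx.1 hx.2⟩⟩

variable [IsDomain R]

theorem rkR_cls (M : FGModuleCat.{u} R) : rkR R (HR.cls M) = Module.finrank R M := by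
  rw [HR.cls, rkR_tmul, rk_cls, one_mul, Int.cast_natCast]

theorem rkR_eq_of_mem_mcmPoints {x : HR R} (hx : x ∈ mcmPoints R r) : rkR R x = r := by
  obtain ⟨M, -, rfl, rfl⟩ := hx
  exact rkR_cls M

theorem rkR_pos_of_mem_mcmCone (hr : 0 < r) {x : HR R} (hx : x ∈ mcmCone R r) (hx0 : x ≠ 0) :
    0 < rkR R x :=
  pos_of_mem_hull (fun y hy ↦ by rw [rkR_eq_of_mem_mcmPoints hy]; positivity) hx hx0

theorem rkR_nonneg_of_mem_mcmCone {x : HR R} (hx : x ∈ mcmCone R r) : 0 ≤ rkR R x := by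
  have h : mcmCone R r ≤ (PointedCone.positive ℝ ℝ).comap (rkR R) :=
    Submodule.span_le.mpr fun y hy ↦ (Nat.cast_nonneg r).trans_eq (rkR_eq_of_mem_mcmPoints hy).symm
  exact h hx

theorem rkR_nonneg_of_mem_coneClosure {x : HR R} (hx : x ∈ coneClosure r b) : 0 ≤ rkR R x := by
  let := euclideanNorm b
  let := euclideanNormedSpace b
  have := b.finiteDimensional_of_finite
  exact nonneg_of_mem_closure (rkR R).continuous_of_finiteDimensional
    (fun _ ↦ rkR_nonneg_of_mem_mcmCone) hx

theorem closureMeetsKTrivially_iff : ClosureMeetsKTrivially r b ↔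
    ∀ x ∈ coneClosure r b, rkR R x = 0 → x = 0 := by
  have h0 : (0 : HR R) ∈ coneClosure r b := mcmCone_subset_coneClosure b (zero_mem _)
  rw [ClosureMeetsKTrivially, Set.eq_singleton_iff_unique_mem]
  exact ⟨fun h x hx hx0 ↦ h.2 x ⟨hx, (mem_KR_iff R x).mpr hx0⟩,
    fun h ↦ ⟨⟨h0, zero_mem _⟩, fun x hx ↦ h x hx.1 ((mem_KR_iff R x).mp hx.2)⟩⟩

theorem ConePolyhedral.coneClosed (hr : 0 < r) (h : ConePolyhedral R r) : ConeClosed r b := by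
  obtain ⟨s, hs⟩ := h
  have hs' : mcmCone R r = PointedCone.hull ℝ ((s : Set (HR R)) \ {0}) :=
    hs.trans Submodule.span_sdiff_singleton_zero.symm
  have hpos : ∀ x ∈ (s : Set (HR R)) \ {0}, 0 < rkR R x := fun x hx ↦
    rkR_pos_of_mem_mcmCone hr (hs ▸ PointedCone.subset_hull hx.1) hx.2
  let := euclideanNorm b
  let := euclideanNormedSpace b
  have := b.finiteDimensional_of_finite
  have hclosed : IsClosed (mcmCone R r : Set (HR R)) := hs' ▸ isClosed_hull_of_finite
    (rkR R).continuous_of_finiteDimensional s.finite_toSet.sdiff hpos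
  exact hclosed

theorem ConeClosed.closureMeetsKTrivially (hr : 0 < r) (h : ConeClosed r b) :
    ClosureMeetsKTrivially r b := by
  have hclosure : coneClosure r b = mcmCone R r :=
    letI := euclideanMetric b
    IsClosed.closure_eq h
  rw [closureMeetsKTrivially_iff, hclosure]
  exact fun x hx hx0 ↦ by_contra fun hne ↦ (rkR_pos_of_mem_mcmCone hr hx hne).ne' hx0

theorem closureMeetsKTrivially_iff_sliceBounded (hr : 0 < r) :
    ClosureMeetsKTrivially r b ↔ SliceBounded r b := by
  rw [closureMeetsKTrivially_iff]
  let := euclideanNorm b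
  let := euclideanNormedSpace b
  have := b.finiteDimensional_of_finite
  have := FiniteDimensional.proper ℝ (HR R)
  exact (isBounded_setOf_eq_iff (rkR R).continuous_of_finiteDimensional
    (fun _ ↦ rkR_pos_of_mem_mcmCone hr) (Nat.cast_pos.mpr hr)).symm

theorem ClosureMeetsKTrivially.closureStronglyConvex (h : ClosureMeetsKTrivially r b) :
    ClosureStronglyConvex r b := by
  rw [closureMeetsKTrivially_iff] at h
  rw [closureStronglyConvex_iff]
  refine fun x hx hx' ↦ h x hx (le_antisymm ?_ (rkR_nonneg_of_mem_coneClosure b hx))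
  have hneg := rkR_nonneg_of_mem_coneClosure b hx'
  rwa [map_neg, neg_nonneg] at hneg

theorem SliceBounded.finitelyManyPoints [Module.Finite ℤ (H R)] (h : SliceBounded r b) :
    FinitelyManyPoints R r := by
  have hfin : {a : H R | 1 ⊗ₜ a ∈ {x | x ∈ mcmCone R r ∧ rkR R x = r}}.Finite := by
    refine finite_setOf_one_tmul_mem fun l ↦ ?_
    let := euclideanNorm b
    let := euclideanNormedSpace b
    have := b.finiteDimensional_of_finite
    exact h.image (LinearMap.toContinuousLinearMap l)
  refine finitelyManyPoints_iff.mpr ((hfin.image ((1 : ℝ) ⊗ₜ[ℤ] ·)).subset fun x hx ↦ ?_)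
  have hx' : x ∈ mcmCone R r ∧ rkR R x = r :=
    ⟨mcmPoints_subset_mcmCone hx, rkR_eq_of_mem_mcmPoints hx⟩
  obtain ⟨M, -, -, rfl⟩ := hx
  exact ⟨H.cls M, hx', rfl⟩

theorem FinitelyManyPoints.finitelyManyMCM [IsNoetherianRing R] [IsIntegrallyClosed R]
    [Module.Finite ℤ (H R)] (h : FinitelyManyPoints R 1) : FinitelyManyMCM R 1 := by
  have hfin : {a : H R | 1 ⊗ₜ a ∈ mcmPoints R 1}.Finite :=
    finite_setOf_one_tmul_mem fun l ↦ ((finitelyManyPoints_iff.mp h).image l).isBounded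
  let D : Set (FGModuleCat.{u} R) := {M | IsMCM R M ∧ Module.finrank R M = 1}
  have hD : (H.cls '' D).Finite := hfin.subset <| by
    rintro _ ⟨M, ⟨hM, hM1⟩, rfl⟩
    exact ⟨M, hM, hM1, rfl⟩
  obtain ⟨S, hSD, hS⟩ := Set.exists_subset_bijOn D H.cls
  refine ⟨S, hS.finite_iff_finite.mpr hD, fun M hM hM1 ↦ ?_⟩
  obtain ⟨N, hN, hNM⟩ := hS.surjOn ⟨M, ⟨hM, hM1⟩, rfl⟩
  exact ⟨N, hN, nonempty_linearEquiv_of_H_cls_eq hM (hSD hN).1 hM1 (hSD hN).2 hNM.symm⟩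

section CanonicalModule

variable [IsNoetherianRing R] [IsIntegrallyClosed R] {ω : FGModuleCat.{u} R}

theorem smul_cls_sub_mem_mcmPoints (hR : IsMCM R R) (hω : IsCanonicalModule R ω)
    {x : HR R} (hx : x ∈ mcmPoints R r) :
    (r : ℝ) • (HR.cls (FGModuleCat.of R R) + HR.cls ω) - x ∈ mcmPoints R r := by
  obtain ⟨M, hM, rfl, rfl⟩ := hx
  have hω1 := hω.finrank_eq_one
  have := hM.isTorsionFree
  have := hω.isMCM.isTorsionFree
  refine ⟨FGModuleCat.of R (M →ₗ[R] ω), isMCM_linearMap hR hM hω, ?_, ?_⟩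
  · exact finrank_linearMap_of_isDomain.trans (by rw [hω1, mul_one])
  · have h := congr_arg ((1 : ℝ) ⊗ₜ[ℤ] ·) (H.cls_linearMap_add_cls M ω hω1)
    simp only [TensorProduct.tmul_add, TensorProduct.tmul_smul] at h
    rw [sub_eq_iff_eq_add, Nat.cast_smul_eq_nsmul ℝ]
    exact h.symm

theorem rkR_smul_cls_sub_mem_mcmCone (hR : IsMCM R R) (hω : IsCanonicalModule R ω) {x : HR R}
    (hx : x ∈ mcmCone R r) :
    rkR R x • (HR.cls (FGModuleCat.of R R) + HR.cls ω) - x ∈ mcmCone R r := by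
  let w := HR.cls (FGModuleCat.of R R) + HR.cls ω
  have h : mcmCone R r ≤ (mcmCone R r).comap ((rkR R).smulRight w - LinearMap.id) := by
    refine Submodule.span_le.mpr fun y hy ↦ mcmPoints_subset_mcmCone ?_
    change rkR R y • w - y ∈ mcmPoints R r
    rw [rkR_eq_of_mem_mcmPoints hy]
    exact smul_cls_sub_mem_mcmPoints hR hω hy
  exact h hx

theorem ClosureStronglyConvex.closureMeetsKTrivially (hR : IsMCM R R)
    (hω : IsCanonicalModule R ω) (h : ClosureStronglyConvex r b) :
    ClosureMeetsKTrivially r b := by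
  rw [closureStronglyConvex_iff] at h
  rw [closureMeetsKTrivially_iff]
  refine fun x hx hx0 ↦ h x hx ?_
  let := euclideanNorm b
  let := euclideanNormedSpace b
  have := b.finiteDimensional_of_finite
  exact neg_mem_closure_of_forall_smul_sub_mem (rkR R).continuous_of_finiteDimensional
    (fun _ ↦ rkR_smul_cls_sub_mem_mcmCone hR hω) hx hx0

end CanonicalModule

end Conditions

end CMCone

end

theorem theorem1p3 (R : Type u) [CommRing R] [IsDomain R] [IsNoetherianRing R]
    [FiniteDimensional ℝ (CMCone.HR R)] (r : ℕ) (hr : 0 < r)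
    (n : ℕ) (b : Module.Basis (Fin n) ℝ (CMCone.HR R)) :
    ((CMCone.FinitelyManyMCM R r → CMCone.FinitelyManyPoints R r) ∧
      (CMCone.FinitelyManyPoints R r → CMCone.ConePolyhedral R r) ∧
      (CMCone.ConePolyhedral R r → CMCone.ConeClosed r b) ∧
      (CMCone.ConeClosed r b → CMCone.ClosureMeetsKTrivially r b) ∧
      (CMCone.ClosureMeetsKTrivially r b ↔ CMCone.SliceBounded r b) ∧
      (CMCone.SliceBounded r b → CMCone.ClosureStronglyConvex r b)) ∧
    (Module.Finite ℤ (CMCone.H R) →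
      List.TFAE [CMCone.FinitelyManyPoints R r, CMCone.ConePolyhedral R r,
        CMCone.ConeClosed r b, CMCone.ClosureMeetsKTrivially r b, CMCone.SliceBounded r b]) ∧
    (IsIntegrallyClosed R → Module.Finite ℤ (CMCone.H R) → r = 1 →
      List.TFAE [CMCone.FinitelyManyMCM R r, CMCone.FinitelyManyPoints R r,
        CMCone.ConePolyhedral R r, CMCone.ConeClosed r b,
        CMCone.ClosureMeetsKTrivially r b, CMCone.SliceBounded r b]) ∧
    (IsIntegrallyClosed R → CMCone.IsMCM R R →
      (∃ ω : FGModuleCat.{u} R, CMCone.IsCanonicalModule R ω) →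
      (CMCone.ClosureMeetsKTrivially r b ↔ CMCone.ClosureStronglyConvex r b)) := by
  have hbc : CMCone.FinitelyManyPoints R r → CMCone.ConePolyhedral R r := (·.conePolyhedral)
  have hcd : CMCone.ConePolyhedral R r → CMCone.ConeClosed r b := (·.coneClosed b hr)
  have hde : CMCone.ConeClosed r b → CMCone.ClosureMeetsKTrivially r b :=
    (·.closureMeetsKTrivially b hr)
  have hef := CMCone.closureMeetsKTrivially_iff_sliceBounded b hr
  have heg : CMCone.ClosureMeetsKTrivially r b → CMCone.ClosureStronglyConvex r b :=
    (·.closureStronglyConvex b)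
  have hbf (_ : Module.Finite ℤ (CMCone.H R)) : List.TFAE [CMCone.FinitelyManyPoints R r,
      CMCone.ConePolyhedral R r, CMCone.ConeClosed r b, CMCone.ClosureMeetsKTrivially r b,
      CMCone.SliceBounded r b] := by
    tfae_have 1 → 2 := hbc
    tfae_have 2 → 3 := hcd
    tfae_have 3 → 4 := hde
    tfae_have 4 ↔ 5 := hef
    tfae_have 5 → 1 := (·.finitelyManyPoints b)
    tfae_finish
  refine ⟨⟨(·.finitelyManyPoints), hbc, hcd, hde, hef, heg ∘ hef.mpr⟩, hbf,
    fun _ hH hr1 ↦ List.tfae_cons_cons.mpr ⟨⟨(·.finitelyManyPoints), fun hb ↦ ?_⟩, hbf hH⟩,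
    fun _ hR ⟨_, hω⟩ ↦ ⟨heg, (·.closureMeetsKTrivially b hR hω)⟩⟩
  subst hr1
  exact hb.finitelyManyMCM
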